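/- **Setting.** For $r\ge 1$ let $\phi_r(x)=e^{x^r}-1$, $x\ge 0$. On a probability space let $(\varphi_t,\xi_t,\tilde\xi_t)_{t\ge 0}$ be a process, where $\varphi_t$ is an observed state (with values in a standard Borel space), $\xi_t$ a hidden state, and $\tilde\xi_t$ a statistic used to form beliefs about $\xi_t$. Write $\tilde X_t=(\varphi_t,\tilde\xi_t)$. Assume (Condition S-Learn): 1. given the history of $(\varphi_i,\xi_i,\tilde\xi_i)_{i\le t}$, the conditional distribution of $(\varphi_{t+1},\xi_{t+1})$ is $Q_\varphi(\cdot\,|\,\xi_t)\otimes Q_\xi(\cdot\,|\,\xi_t)$ for Markov kernels $Q_\varphi,Q_\xi$; 2. the posterior distribution of $\xi_t$ given $\tilde X_t$ is $\Pi_\xi(\cdot\,|\,\varphi_t,\tilde\xi_t)$ for a Markov kernel $\Pi_\xi$, and $\tilde\xi_{t+1}=\Xi(\tilde\xi_t,\varphi_{t+1})$ almost surely for a measurable map $\Xi$; 3. $\{(\xi_t,\tilde X_t)\}_{t\ge0}$ is strictly stationary. Let $\tilde Q_0$ be the law of $\tilde X_t$, and let $E^{\phi_r}_{\varphi}$ (resp.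 $E^{\phi_r}_{\tilde\xi}$) be the set of measurable real functions $f$ of $\varphi$ only (resp. of $\tilde\xi$ only) such that $\mathbb E^{\tilde Q_0}[\phi_r(|f|/c)]<\infty$ for every $c>0$, functions being identified when they are equal $\tilde Q_0$-almost everywhere. Let $\mathbb E^{\Pi_\xi}[g(\xi_t)\,|\,\tilde\xi_t=s]=\mathbb E\big[\int g\,d\Pi_\xi(\cdot\,|\,\varphi_t,s)\,\big|\,\tilde\xi_t=s\big]$ (which is $\int g\, d\Pi_\xi(\cdot\,|\,s)$ when the posterior depends on $\tilde\xi_t$ alone). Let $\beta\in(0,1)$, $\theta>0$, $\alpha\in\mathbb R$ (for example $\alpha=-1/(\theta(1-\beta))$), and let $u$ be a real function of $\varphi$ (utility growth is $u(\varphi_{t+1})$). For $\vartheta\in(0,\infty)$ define $$\tilde{\mathbb T} f(\tilde\xi_t)=\beta\log \mathbb E^{\Pi_\xi}\Big[\,\mathbb E^{Q_\varphi}\big[e^{\frac{\theta}{\vartheta}f(\Xi(\tilde\xi_t,\varphi_{t+1}))+\alpha u(\varphi_{t+1})}\,\big|\,\xi_t,\tilde\xi_t\big]^{\vartheta/\theta}\,\Big|\,\tilde\xi_t\Big],$$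 and for $\vartheta=+\infty$ $$\tilde{\mathbb T} f(\tilde\xi_t)=\beta\log \mathbb E^{\Pi_\xi}\Big[\,e^{\mathbb E^{Q_\varphi}[f(\Xi(\tilde\xi_t,\varphi_{t+1}))+\alpha u(\varphi_{t+1})\,|\,\xi_t,\tilde\xi_t]}\,\Big|\,\tilde\xi_t\Big].$$ **Theorem.** Let $u\in E^{\phi_r}_{\varphi}$ for some $r>1$. Then, for every $\vartheta\in(0,\infty]$, $\tilde{\mathbb T}$ is a well-defined operator from $E^{\phi_s}_{\tilde\xi}$ to itself for each $1\le s\le r$ (all expectations in its definition are finite almost everywhere). It has a fixed point $v\in E^{\phi_r}_{\tilde\xi}$. Moreover, $v$ is the unique fixed point of $\tilde{\mathbb T}$ in $E^{\phi_s}_{\tilde\xi}$ for each $1<s\le r$. -/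

import Mathlib

open MeasureTheory ProbabilityTheory

/-- The Young function `φ_r(x) = exp(x ^ r) - 1` (used for `x ≥ 0`, `r ≥ 1`). -/
noncomputable def youngExp (r x : ℝ) : ℝ := Real.exp (x ^ r) - 1

/-- The Orlicz heart `E^{φ_r}(μ)`: measurable real functions `f` such that
`∫ φ_r(|f| / c) dμ < ∞` for every `c > 0`. Elements are functions; equality in the paper's
space of equivalence classes is `μ`-almost-everywhere equality. -/
def orliczHeart {X : Type*} [MeasurableSpace X] (μ : Measure X) (r : ℝ) : Set (X → ℝ) :=
  {f | Measurable f ∧ ∀ c : ℝ, 0 < c → Integrable (fun x => youngExp r (|f x| / c)) μ}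

/-- `E^{φ_r}_φ`: functions of the observed state `φ` which, as functions of `X̃ = (φ, ξ̃)`, lie
in the Orlicz heart of the law `Q₀` of `X̃`. -/
def orliczHeartObs {F S : Type*} [MeasurableSpace F] [MeasurableSpace S]
    (Q₀ : Measure (F × S)) (r : ℝ) : Set (F → ℝ) :=
  {f | Measurable f ∧ (fun x : F × S => f x.1) ∈ orliczHeart Q₀ r}

/-- `E^{φ_r}_ξ̃`: functions of the sufficient statistic `ξ̃` which, as functions of
`X̃ = (φ, ξ̃)`, lie in the Orlicz heart of the law `Q₀` of `X̃`. -/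
def orliczHeartStat {F S : Type*} [MeasurableSpace F] [MeasurableSpace S]
    (Q₀ : Measure (F × S)) (r : ℝ) : Set (S → ℝ) :=
  {f | Measurable f ∧ (fun x : F × S => f x.2) ∈ orliczHeart Q₀ r}

/-- Strict stationarity of a discrete-time process: all time shifts have the same law, as
random sequences. -/
def IsStrictlyStationary {Ω Y : Type*} [MeasurableSpace Ω] [MeasurableSpace Y]
    (P : Measure Ω) (Z : ℕ → Ω → Y) : Prop :=
  ∀ k : ℕ, P.map (fun ω (t : ℕ) => Z (t + k) ω) = P.map (fun ω (t : ℕ) => Z t ω)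

/-- The learning environment. `obs t` is the observed state `φ_t`, `hid t` the hidden state
`ξ_t`, `stat t` the sufficient statistic `ξ̃_t`; `Qobs` and `Qhid` are the two factors of the
transition distribution of `X = (φ, ξ)`, `post` is the posterior `Π_ξ(· | φ, ξ̃)`, and `upd` is
the updating rule `Ξ`. -/
structure LearningEnvironment {Ω F H S : Type*} [MeasurableSpace Ω] [MeasurableSpace F]
    [MeasurableSpace H] [MeasurableSpace S] (P : Measure Ω)
    (obs : ℕ → Ω → F) (hid : ℕ → Ω → H) (stat : ℕ → Ω → S)
    (Qobs : Kernel H F) (Qhid : Kernel H H) (post : Kernel (F × S) H) (upd : S → F → S) :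
    Prop where
  measurable_obs : ∀ t, Measurable (obs t)
  measurable_hid : ∀ t, Measurable (hid t)
  measurable_stat : ∀ t, Measurable (stat t)
  measurable_upd : Measurable (fun x : S × F => upd x.1 x.2)
  /-- `X = (φ, ξ)` is first-order Markov: given the history up to date `t`, the conditional
  distribution of `(φ_{t+1}, ξ_{t+1})` is the product `Q_φ(· | ξ_t) Q_ξ(· | ξ_t)`. -/
  markov : ∀ t : ℕ, HasCondDistrib
    (fun ω => (obs (t + 1) ω, hid (t + 1) ω))
    (fun ω (i : Fin (t + 1)) => (obs i ω, hid i ω, stat i ω))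
    ((Qobs ×ₖ Qhid).comap (fun h : Fin (t + 1) → F × H × S => (h (Fin.last t)).2.1)
      (by fun_prop)) P
  /-- Beliefs about `ξ_t` are given by the posterior distribution `Π_ξ(· | φ_t, ξ̃_t)`. -/
  posterior : ∀ t : ℕ, HasCondDistrib (hid t) (fun ω => (obs t ω, stat t ω)) post P
  /-- The statistic is updated by `ξ̃_{t+1} = Ξ(ξ̃_t, φ_{t+1})`. -/
  update : ∀ t : ℕ, ∀ᵐ ω ∂P, stat (t + 1) ω = upd (stat t ω) (obs (t + 1) ω)
  /-- `(ξ_t, X̃_t)` is strictly stationary; in particular so is `X_t = (φ_t, ξ_t)`. -/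
  stationary : IsStrictlyStationary P (fun t ω => (hid t ω, (obs t ω, stat t ω)))

/-- The kernel representing `E^{Π_ξ}[ · | ξ̃_t]`: the posterior `Π_ξ(· | φ, ξ̃)` averaged over
the conditional distribution of `φ_t` given `ξ̃_t` under the law `Q₀` of `X̃_t = (φ_t, ξ̃_t)`.
If `Π_ξ(· | φ, ξ̃)` does not depend on `φ`, this is just `Π_ξ(· | ξ̃)`. -/
noncomputable def postGivenStat {F H S : Type*} [MeasurableSpace F] [StandardBorelSpace F]
    [Nonempty F] [MeasurableSpace H] [MeasurableSpace S] (Q₀ : Measure (F × S))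
    [IsFiniteMeasure Q₀] (post : Kernel (F × S) H) : Kernel S H :=
  post ∘ₖ (condDistrib (Prod.fst : F × S → F) (Prod.snd : F × S → S) Q₀ ×ₖ Kernel.id)

/-- The operator `T̃` for finite `ϑ`:
`T̃ f(ξ̃) = β log E^Π[ E^{Q_φ}[ exp((θ/ϑ) f(Ξ(ξ̃, φ')) + α u(φ')) | ξ ]^{ϑ/θ} | ξ̃ ]`,
where `K = E^Π[ · | ξ̃]`. -/
noncomputable def learnOp {F H S : Type*} [MeasurableSpace F] [MeasurableSpace H]
    [MeasurableSpace S] (β θ ϑ α : ℝ) (K : Kernel S H) (Qobs : Kernel H F)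
    (upd : S → F → S) (u : F → ℝ) (f : S → ℝ) (s : S) : ℝ :=
  β * Real.log (∫ x, (∫ y, Real.exp (θ / ϑ * f (upd s y) + α * u y) ∂(Qobs x)) ^ (ϑ / θ) ∂(K s))

/-- All expectations in `learnOp` at `(f, s)` are genuine (finite) expectations. -/
def LearnOpDefinedAt {F H S : Type*} [MeasurableSpace F] [MeasurableSpace H]
    [MeasurableSpace S] (θ ϑ α : ℝ) (K : Kernel S H) (Qobs : Kernel H F)
    (upd : S → F → S) (u : F → ℝ) (f : S → ℝ) (s : S) : Prop :=
  (∀ᵐ x ∂(K s), Integrable (fun y => Real.exp (θ / ϑ * f (upd s y) + α * u y)) (Qobs x)) ∧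
  Integrable
    (fun x => (∫ y, Real.exp (θ / ϑ * f (upd s y) + α * u y) ∂(Qobs x)) ^ (ϑ / θ)) (K s)

/-- The operator `T̃` for `ϑ = +∞`:
`T̃ f(ξ̃) = β log E^Π[ exp(E^{Q_φ}[ f(Ξ(ξ̃, φ')) + α u(φ') | ξ ]) | ξ̃ ]`. -/
noncomputable def learnOpLim {F H S : Type*} [MeasurableSpace F] [MeasurableSpace H]
    [MeasurableSpace S] (β α : ℝ) (K : Kernel S H) (Qobs : Kernel H F)
    (upd : S → F → S) (u : F → ℝ) (f : S → ℝ) (s : S) : ℝ :=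
  β * Real.log (∫ x, Real.exp (∫ y, (f (upd s y) + α * u y) ∂(Qobs x)) ∂(K s))

/-- All expectations in `learnOpLim` at `(f, s)` are genuine (finite) expectations. -/
def LearnOpLimDefinedAt {F H S : Type*} [MeasurableSpace F] [MeasurableSpace H]
    [MeasurableSpace S] (α : ℝ) (K : Kernel S H) (Qobs : Kernel H F)
    (upd : S → F → S) (u : F → ℝ) (f : S → ℝ) (s : S) : Prop :=
  (∀ᵐ x ∂(K s), Integrable (fun y => f (upd s y) + α * u y) (Qobs x)) ∧
  Integrable (fun x => Real.exp (∫ y, (f (upd s y) + α * u y) ∂(Qobs x))) (K s)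

/-- For an operator `T` on functions of `ξ̃` (with `D f s` saying that `T f (s)` is well defined):
for `1 ≤ s ≤ r`, `T` is a well-defined operator from `E^{φ_s}_ξ̃` to itself; and there is a fixed
point in `E^{φ_r}_ξ̃` which is the unique fixed point in `E^{φ_s}_ξ̃` for each `1 < s ≤ r`.
Functions of `ξ̃` are identified when equal almost everywhere under the law of `ξ̃`. -/
def HasUniqueThinTailedFixedPoint {F S : Type*} [MeasurableSpace F] [MeasurableSpace S]
    (Q₀ : Measure (F × S)) (r : ℝ) (T : (S → ℝ) → S → ℝ) (D : (S → ℝ) → S → Prop) : Prop :=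
  (∀ s : ℝ, 1 ≤ s → s ≤ r → ∀ f ∈ orliczHeartStat Q₀ s,
    (∀ᵐ z ∂(Q₀.map Prod.snd), D f z) ∧ T f ∈ orliczHeartStat Q₀ s) ∧
  ∃ v ∈ orliczHeartStat Q₀ r, T v =ᵐ[Q₀.map Prod.snd] v ∧
    ∀ s : ℝ, 1 < s → s ≤ r → v ∈ orliczHeartStat Q₀ s ∧
      ∀ w ∈ orliczHeartStat Q₀ s, T w =ᵐ[Q₀.map Prod.snd] w → w =ᵐ[Q₀.map Prod.snd] v

/-! Both operators have the form `T f s = β Φ_s (f ∘ upd s + w)`, where `w` is a multiple of `u` and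
`Φ_s` is monotone, convex, at least the mean, and satisfies `exp (q Φ_s h) ≤ ∫ exp (q h)` for all
large `q`. No contraction is used: existence comes from monotonicity, uniqueness from convexity, and
one drift estimate controls both.

Let `μ` be the law of the statistic and `I_c f = ∫ exp ((|f| / c) ^ s) dμ`. For small `c`, `I_c (T
f) ≤ C + β I_c f` with `C` independent of `f` (`RecursiveOperator.integral_exp_rpow_le`). This rests
on a Jensen-type inequality for `exp (x ^ s)` (`CertaintyEquiv.exp_rpow_le`) and on the invariance
of `μ` when the next observation is drawn from its predictive law and the statistic is updated
(`LearningEnvironment.map_obs_upd`).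

Existence: iterates from a subsolution increase, the drift bounds their `I_c`, and Fatou gives a
finite limit in the Orlicz heart. A subsolution is `-a`, where `a` solves `a = β E[a ∘ upd + |w|]`.

Uniqueness: for fixed points `f`, `g`, convexity makes every extrapolation `g + n (f - g)`, `n ≥ 1`,
a subsolution. The drift bounds the exponential moments of their positive parts uniformly in `n`, so
`f ≤ g` almost everywhere. -/

open Filter Topology

/-! ### Functions with all exponential moments -/

/-- `f` is measurable and has exponential moments of all orders, positive and negative. -/
def HasExpMoments {X : Type*} [MeasurableSpace X] (m : Measure X) (f : X → ℝ) : Prop :=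
  Measurable f ∧ ∀ q : ℝ, Integrable (fun x => Real.exp (q * f x)) m

namespace HasExpMoments

variable {X Y : Type*} [MeasurableSpace X] [MeasurableSpace Y] {m : Measure X} {f g : X → ℝ}

theorem exp_mul_le_of_abs_le {q n x : ℝ} (h : |q| ≤ n) :
    Real.exp (q * x) ≤ Real.exp (n * x) + Real.exp (-n * x) := by
  have h1 : q * x ≤ |n * x| := by
    rw [abs_mul, abs_of_nonneg ((abs_nonneg q).trans h)]
    calc q * x ≤ |q * x| := le_abs_self _
      _ = |q| * |x| := abs_mul _ _
      _ ≤ n * |x| := by gcongr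
  rcases abs_cases (n * x) with ⟨h2, -⟩ | ⟨h2, -⟩
  · have := Real.exp_le_exp.2 (h1.trans h2.le)
    linarith [Real.exp_pos (-n * x)]
  · have := Real.exp_le_exp.2 (h1.trans h2.le)
    rw [← neg_mul] at this
    linarith [Real.exp_pos (n * x)]

/-- Countably many exponents suffice, which later allows one null set to serve for all `q` after
disintegration. -/
theorem of_nat (hf : Measurable f)
    (h : ∀ n : ℕ, Integrable (fun x => Real.exp (n * f x)) m ∧
      Integrable (fun x => Real.exp (-n * f x)) m) : HasExpMoments m f := by
  refine ⟨hf, fun q => ?_⟩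
  obtain ⟨n, hn⟩ := exists_nat_ge |q|
  refine ((h n).1.add (h n).2).mono' (by fun_prop) (ae_of_all _ fun x => ?_)
  rw [Real.norm_of_nonneg (Real.exp_pos _).le]
  exact exp_mul_le_of_abs_le hn

theorem of_exp_mul_abs (hf : Measurable f)
    (h : ∀ n : ℕ, Integrable (fun x => Real.exp (n * |f x|)) m) : HasExpMoments m f := by
  refine of_nat hf fun n => ⟨?_, ?_⟩ <;>
  · refine (h n).mono' (by fun_prop) (ae_of_all _ fun x => ?_)
    rw [Real.norm_of_nonneg (Real.exp_pos _).le, Real.exp_le_exp]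
    have : (0 : ℝ) ≤ n := by positivity
    nlinarith [neg_abs_le (f x), le_abs_self (f x)]

theorem const_mul (hf : HasExpMoments m f) (c : ℝ) : HasExpMoments m (fun x => c * f x) :=
  ⟨hf.1.const_mul c, fun q => by simpa only [mul_assoc] using hf.2 (q * c)⟩

theorem neg (hf : HasExpMoments m f) : HasExpMoments m (fun x => -f x) := by
  simpa using hf.const_mul (-1)

theorem add (hf : HasExpMoments m f) (hg : HasExpMoments m g) :
    HasExpMoments m (fun x => f x + g x) := by
  refine ⟨hf.1.add hg.1, fun q => ?_⟩
  refine ((hf.2 (2 * q)).add (hg.2 (2 * q))).mono' ?_ (ae_of_all _ fun x => ?_)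
  · have := hf.1; have := hg.1; fun_prop
  · rw [Real.norm_of_nonneg (Real.exp_pos _).le]
    -- Doubling the exponent replaces a product by squares, through `a b ≤ a² + b²`.
    have h1 : Real.exp (q * (f x + g x)) = Real.exp (q * f x) * Real.exp (q * g x) := by
      rw [← Real.exp_add]; ring_nf
    have h2 : Real.exp (2 * q * f x) = Real.exp (q * f x) ^ 2 := by
      rw [← Real.exp_nat_mul]; push_cast; ring_nf
    have h3 : Real.exp (2 * q * g x) = Real.exp (q * g x) ^ 2 := by
      rw [← Real.exp_nat_mul]; push_cast; ring_nf
    rw [Pi.add_apply, h1, h2, h3]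
    nlinarith [sq_nonneg (Real.exp (q * f x) - Real.exp (q * g x)),
      sq_nonneg (Real.exp (q * f x)), sq_nonneg (Real.exp (q * g x))]

theorem sub (hf : HasExpMoments m f) (hg : HasExpMoments m g) :
    HasExpMoments m (fun x => f x - g x) := by
  simpa only [sub_eq_add_neg] using hf.add hg.neg

theorem of_abs_le (hg : HasExpMoments m g) (hf : Measurable f) (h : ∀ᵐ x ∂m, |f x| ≤ |g x|) :
    HasExpMoments m f := by
  refine ⟨hf, fun q => ((hg.2 |q|).add (hg.2 (-|q|))).mono' (by fun_prop) ?_⟩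
  filter_upwards [h] with x hx
  rw [Real.norm_of_nonneg (Real.exp_pos _).le]
  have h1 : Real.exp (q * f x) ≤ Real.exp (|q| * |g x|) := by
    rw [Real.exp_le_exp]
    calc q * f x ≤ |q * f x| := le_abs_self _
      _ = |q| * |f x| := abs_mul _ _
      _ ≤ _ := by gcongr
  refine h1.trans ?_
  rcases abs_cases (g x) with ⟨h2, -⟩ | ⟨h2, -⟩
  · rw [h2]; exact le_add_of_nonneg_right (Real.exp_pos _).le
  · rw [h2, mul_neg, ← neg_mul]; exact le_add_of_nonneg_left (Real.exp_pos _).le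

theorem abs (hf : HasExpMoments m f) : HasExpMoments m (fun x => |f x|) :=
  hf.of_abs_le (by simpa using hf.1.norm) (ae_of_all _ fun x => by simp)

theorem pos_part (hf : HasExpMoments m f) : HasExpMoments m (fun x => max (f x) 0) :=
  hf.of_abs_le (hf.1.max measurable_const) (ae_of_all _ fun x => by
    rw [abs_of_nonneg (le_max_right _ _)]
    exact max_le (le_abs_self _) (abs_nonneg _))

theorem integrable (hf : HasExpMoments m f) : Integrable f m := by
  refine ((hf.2 1).add (hf.2 (-1))).mono' hf.1.aestronglyMeasurable (ae_of_all _ fun x => ?_)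
  simp only [Real.norm_eq_abs, Pi.add_apply]
  rcases abs_cases (f x) with ⟨h2, -⟩ | ⟨h2, -⟩ <;> rw [h2] <;>
    linarith [Real.add_one_le_exp (1 * f x), Real.add_one_le_exp (-1 * f x),
      Real.exp_pos (1 * f x), Real.exp_pos (-1 * f x)]

theorem of_map {φ : X → Y} {F : Y → ℝ} (hφ : Measurable φ) (h : HasExpMoments (m.map φ) F) :
    HasExpMoments m (fun x => F (φ x)) :=
  ⟨h.1.comp hφ, fun q => (h.2 q).comp_measurable hφ⟩

theorem ae_of_compProd [SFinite m] {κ : Kernel X Y} [IsSFiniteKernel κ] {F : X × Y → ℝ}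
    (h : HasExpMoments (m ⊗ₘ κ) F) : ∀ᵐ x ∂m, HasExpMoments (κ x) (fun y => F (x, y)) := by
  have key : ∀ q : ℝ, ∀ᵐ x ∂m, Integrable (fun y => Real.exp (q * F (x, y))) (κ x) := fun q =>
    ((Measure.integrable_compProd_iff (h.2 q).1).1 (h.2 q)).1
  have h1 : ∀ᵐ x ∂m, ∀ n : ℕ, Integrable (fun y => Real.exp (n * F (x, y))) (κ x) :=
    ae_all_iff.2 fun n => key n
  have h2 : ∀ᵐ x ∂m, ∀ n : ℕ, Integrable (fun y => Real.exp (-n * F (x, y))) (κ x) :=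
    ae_all_iff.2 fun n => key (-n)
  filter_upwards [h1, h2] with x h1 h2
  exact of_nat (h.1.comp measurable_prodMk_left) fun n => ⟨h1 n, h2 n⟩

theorem ae_of_comp [SFinite m] {κ : Kernel X Y} [IsSFiniteKernel κ] {F : Y → ℝ}
    (h : HasExpMoments (κ ∘ₘ m) F) : ∀ᵐ x ∂m, HasExpMoments (κ x) F := by
  rw [← Measure.snd_compProd] at h
  exact (h.of_map measurable_snd).ae_of_compProd

end HasExpMoments

/-! ### Certainty equivalents: mean, entropic, and their compositions -/

/-- A certainty equivalent: a monotone convex functional lying between the mean and the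
entropic functionals `q⁻¹ log ∫ exp (q f)`, `q ≥ p`, and continuous along monotone sequences. -/
structure CertaintyEquiv {X : Type*} [MeasurableSpace X] (m : Measure X) (p : ℝ)
    (Φ : (X → ℝ) → ℝ) : Prop where
  mono : ∀ {f g}, HasExpMoments m f → HasExpMoments m g → f ≤ᵐ[m] g → Φ f ≤ Φ g
  mean_le : ∀ {f}, HasExpMoments m f → ∫ x, f x ∂m ≤ Φ f
  exp_le : ∀ {f}, HasExpMoments m f → ∀ q : ℝ, p ≤ q →
    Real.exp (q * Φ f) ≤ ∫ x, Real.exp (q * f x) ∂m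
  convex : ∀ {f g}, HasExpMoments m f → HasExpMoments m g → ∀ a b : ℝ, 0 ≤ a → 0 ≤ b → a + b = 1 →
    Φ (fun x => a * f x + b * g x) ≤ a * Φ f + b * Φ g
  tendsto : ∀ {f : ℕ → X → ℝ} {g}, (∀ n, HasExpMoments m (f n)) → HasExpMoments m g →
    (∀ᵐ x ∂m, Monotone fun n => f n x) → (∀ᵐ x ∂m, Tendsto (fun n => f n x) atTop (𝓝 (g x))) →
    Tendsto (fun n => Φ (f n)) atTop (𝓝 (Φ g))

theorem HasExpMoments.exp_integral_le {X : Type*} [MeasurableSpace X] {m : Measure X}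
    [IsProbabilityMeasure m] {f : X → ℝ} (hf : HasExpMoments m f) (q : ℝ) :
    Real.exp (q * ∫ x, f x ∂m) ≤ ∫ x, Real.exp (q * f x) ∂m := by
  have := convexOn_exp.map_integral_le (μ := m) (f := fun x => q * f x)
    Real.continuous_exp.continuousOn isClosed_univ (by simp) (hf.integrable.const_mul q) (hf.2 q)
  rwa [integral_const_mul] at this

namespace CertaintyEquiv

variable {X Y : Type*} [MeasurableSpace X] [MeasurableSpace Y] {m : Measure X} {p : ℝ}
  {Φ Ψ : (X → ℝ) → ℝ}

theorem congr (h : CertaintyEquiv m p Φ) (hΨ : ∀ f, HasExpMoments m f → Ψ f = Φ f) :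
    CertaintyEquiv m p Ψ where
  mono hf hg hfg := by rw [hΨ _ hf, hΨ _ hg]; exact h.mono hf hg hfg
  mean_le hf := by rw [hΨ _ hf]; exact h.mean_le hf
  exp_le hf := by rw [hΨ _ hf]; exact h.exp_le hf
  convex hf hg a b ha hb hab := by
    rw [hΨ _ hf, hΨ _ hg, hΨ _ ((hf.const_mul a).add (hg.const_mul b))]
    exact h.convex hf hg a b ha hb hab
  tendsto hf hg := by
    rw [hΨ _ hg, funext fun n => hΨ _ (hf n)]
    exact h.tendsto hf hg

/-- `Φ` has no symmetry under sign change, so the lower bound passes through the mean: `-Φ f ≤ -E f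
≤ E |f| ≤ Φ |f|`. -/
theorem abs_le (h : CertaintyEquiv m p Φ) {f : X → ℝ} (hf : HasExpMoments m f) :
    |Φ f| ≤ Φ (fun x => |f x|) := by
  refine _root_.abs_le.2 ⟨?_, h.mono hf hf.abs (ae_of_all _ fun x => le_abs_self _)⟩
  rw [neg_le]
  calc -Φ f ≤ -∫ x, f x ∂m := neg_le_neg (h.mean_le hf)
    _ = ∫ x, -f x ∂m := (integral_neg _).symm
    _ ≤ ∫ x, |f x| ∂m := integral_mono hf.neg.integrable hf.abs.integrable
        fun x => neg_le_abs (f x)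
    _ ≤ _ := h.mean_le hf.abs

theorem exp_mul_abs_le (h : CertaintyEquiv m p Φ) {f : X → ℝ} (hf : HasExpMoments m f) {q : ℝ}
    (hq : p ≤ q) (hq0 : 0 ≤ q) : Real.exp (q * |Φ f|) ≤ ∫ x, Real.exp (q * |f x|) ∂m :=
  (Real.exp_le_exp.2 (mul_le_mul_of_nonneg_left (h.abs_le hf) hq0)).trans (h.exp_le hf.abs q hq)

theorem mean [IsProbabilityMeasure m] (p : ℝ) :
    CertaintyEquiv m p (fun f => ∫ x, f x ∂m) where
  mono hf hg hfg := integral_mono_ae hf.integrable hg.integrable hfg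
  mean_le _ := le_rfl
  exp_le hf q _ := hf.exp_integral_le q
  convex hf hg a b _ _ _ := by
    rw [integral_add (hf.const_mul a).integrable (hg.const_mul b).integrable,
      integral_const_mul, integral_const_mul]
  tendsto hf hg hm ht :=
    integral_tendsto_of_tendsto_of_monotone (fun n => (hf n).integrable) hg.integrable hm ht

theorem entropic [IsProbabilityMeasure m] {k : ℝ} (hk : 0 < k) (hkp : k ≤ p) :
    CertaintyEquiv m p (fun f => k⁻¹ * Real.log (∫ x, Real.exp (k * f x) ∂m)) where
  mono {f g} hf hg hfg := by
    refine mul_le_mul_of_nonneg_left ?_ (inv_nonneg.2 hk.le)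
    refine Real.log_le_log (integral_exp_pos (hf.2 k)) (integral_mono_ae ?_ ?_ ?_)
    · exact hf.2 k
    · exact hg.2 k
    · filter_upwards [hfg] with x hx
      gcongr
  mean_le {f} hf := by
    rw [inv_mul_eq_div, le_div_iff₀ hk, mul_comm,
      Real.le_log_iff_exp_le (integral_exp_pos (hf.2 k))]
    exact hf.exp_integral_le k
  exp_le {f} hf q hq := by
    have hpos := integral_exp_pos (hf.2 k)
    -- Jensen for the convex power `x ^ (q / k)` compares the exponents `k` and `q`.
    have hqk : 1 ≤ q / k := (one_le_div hk).2 (hkp.trans hq)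
    have h1 : Real.exp (q * (k⁻¹ * Real.log (∫ x, Real.exp (k * f x) ∂m))) =
        (∫ x, Real.exp (k * f x) ∂m) ^ (q / k) := by
      rw [Real.rpow_def_of_pos hpos]; congr 1; field_simp
    have h2 : ∀ x, Real.exp (k * f x) ^ (q / k) = Real.exp (q * f x) := fun x => by
      rw [← Real.exp_mul]; congr 1; field_simp
    rw [h1]
    have := (convexOn_rpow hqk).map_integral_le (μ := m) (f := fun x => Real.exp (k * f x))
      (Real.continuous_rpow_const (by positivity)).continuousOn isClosed_Ici
      (ae_of_all _ fun x => (Real.exp_pos _).le) (hf.2 k)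
      (by simpa only [Function.comp_def, h2] using hf.2 q)
    simpa only [h2] using this
  convex {f g} hf hg a b ha hb hab := by
    have hA := integral_exp_pos (hf.2 k)
    have hB := integral_exp_pos (hg.2 k)
    set A := ∫ x, Real.exp (k * f x) ∂m
    set B := ∫ x, Real.exp (k * g x) ∂m
    have hfg := (hf.const_mul a).add (hg.const_mul b)
    -- Hölder's inequality: divided by `A` and `B`, both exponentials have integral one, and
    -- convexity of `exp` can be integrated pointwise.
    have key : ∫ x, Real.exp (k * (a * f x + b * g x)) ∂m ≤ Real.exp (a * Real.log A + b * Real.log B) := by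
      have h1 : ∀ x, Real.exp (k * (a * f x + b * g x)) ≤
          Real.exp (a * Real.log A + b * Real.log B) *
            (a * (Real.exp (k * f x) / A) + b * (Real.exp (k * g x) / B)) := fun x => by
        have := convexOn_exp.2 (Set.mem_univ (k * f x - Real.log A))
          (Set.mem_univ (k * g x - Real.log B)) ha hb hab
        simp only [smul_eq_mul, Real.exp_sub, Real.exp_log hA, Real.exp_log hB] at this
        calc _ = Real.exp (a * Real.log A + b * Real.log B) *
              Real.exp (a * (k * f x - Real.log A) + b * (k * g x - Real.log B)) := by
              rw [← Real.exp_add]; ring_nf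
          _ ≤ _ := by gcongr
      have hi1 := ((hf.2 k).div_const A).const_mul a
      have hi2 := ((hg.2 k).div_const B).const_mul b
      refine (integral_mono (hfg.2 k) ((hi1.add hi2).const_mul _) h1).trans_eq ?_
      simp only [Pi.add_apply]
      rw [integral_const_mul, integral_add hi1 hi2, integral_const_mul, integral_const_mul,
        integral_div, integral_div, div_self hA.ne', div_self hB.ne', mul_one, mul_one, hab,
        mul_one]
    calc k⁻¹ * Real.log (∫ x, Real.exp (k * (a * f x + b * g x)) ∂m)
        ≤ k⁻¹ * (a * Real.log A + b * Real.log B) := by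
          gcongr
          exact (Real.log_le_iff_le_exp (integral_exp_pos (hfg.2 k))).2 key
      _ = _ := by ring
  tendsto {f g} hf hg hm ht := by
    refine Tendsto.const_mul _ (Tendsto.log ?_ (integral_exp_pos (hg.2 k)).ne')
    refine integral_tendsto_of_tendsto_of_monotone (fun n => (hf n).2 k) (hg.2 k) ?_ ?_
    · filter_upwards [hm] with x hx i j hij
      have := hx hij
      simp only at this ⊢
      gcongr
    · filter_upwards [ht] with x hx
      exact (hx.const_mul k).rexp

theorem integral_comp_measure {ν : Measure Y} {κ : Kernel Y X} {f : X → ℝ}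
    (hf : Integrable f (κ ∘ₘ ν)) : ∫ x, f x ∂(κ ∘ₘ ν) = ∫ y, ∫ x, f x ∂(κ y) ∂ν := by
  rw [Measure.comp_eq_comp_const_apply] at hf ⊢
  rw [ProbabilityTheory.Kernel.integral_comp hf, Kernel.const_apply]

theorem integrable_integral_comp_measure {ν : Measure Y} {κ : Kernel Y X} {f : X → ℝ}
    (hf : Integrable f (κ ∘ₘ ν)) : Integrable (fun y => ∫ x, f x ∂(κ y)) ν := by
  rw [Measure.comp_eq_comp_const_apply] at hf
  simpa using hf.integral_comp

section Composition

variable {ν : Measure Y} {κ : Kernel Y X} [IsMarkovKernel κ] {Φ : Y → (X → ℝ) → ℝ}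

/-- The bound `exp (q |Φ f|) ≤ ∫ exp (q |f|)` is only available for `q ≥ p`; smaller exponents are
dominated by `max p n`. -/
theorem hasExpMoments_comp [SFinite ν] (hΦ : ∀ y, CertaintyEquiv (κ y) p (Φ y))
    (hmeas : ∀ f, Measurable f → Measurable fun y => Φ y f) {f : X → ℝ}
    (hf : HasExpMoments (κ ∘ₘ ν) f) : HasExpMoments ν (fun y => Φ y f) := by
  refine .of_exp_mul_abs (hmeas f hf.1) fun n => ?_
  set q := max p n
  have hq : Integrable (fun x => Real.exp (q * |f x|)) (κ ∘ₘ ν) := hf.abs.2 q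
  have hn : (0 : ℝ) ≤ n := by positivity
  have hm := hmeas f hf.1
  refine (integrable_integral_comp_measure hq).mono' (by fun_prop) ?_
  filter_upwards [hf.ae_of_comp] with y hy
  rw [Real.norm_of_nonneg (Real.exp_pos _).le]
  refine le_trans ?_ ((hΦ y).exp_mul_abs_le hy (le_max_left _ _) (hn.trans (le_max_right _ _)))
  gcongr
  exact le_max_right _ _

/-- Every property is inherited by applying it inside for almost every `y`, then outside. This
covers a functional of the observation nested in one of the hidden state. -/
theorem comp [SFinite ν] {Φ' : (Y → ℝ) → ℝ} (hΦ' : CertaintyEquiv ν p Φ')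
    (hΦ : ∀ y, CertaintyEquiv (κ y) p (Φ y))
    (hmeas : ∀ f, Measurable f → Measurable fun y => Φ y f) :
    CertaintyEquiv (κ ∘ₘ ν) p (fun f => Φ' (fun y => Φ y f)) where
  mono {f g} hf hg hfg := by
    refine hΦ'.mono (hasExpMoments_comp hΦ hmeas hf) (hasExpMoments_comp hΦ hmeas hg) ?_
    filter_upwards [hf.ae_of_comp, hg.ae_of_comp, Measure.ae_ae_of_ae_comp hfg] with y h1 h2 h3
    exact (hΦ y).mono h1 h2 h3
  mean_le {f} hf := by
    rw [integral_comp_measure hf.integrable]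
    have hE := hasExpMoments_comp hΦ hmeas hf
    refine (integral_mono_ae (integrable_integral_comp_measure hf.integrable) hE.integrable ?_).trans
      (hΦ'.mean_le hE)
    filter_upwards [hf.ae_of_comp] with y h1
    exact (hΦ y).mean_le h1
  exp_le {f} hf q hq := by
    rw [integral_comp_measure (hf.2 q)]
    have hE := hasExpMoments_comp hΦ hmeas hf
    refine (hΦ'.exp_le hE q hq).trans
      (integral_mono_ae (hE.2 q) (integrable_integral_comp_measure (hf.2 q)) ?_)
    filter_upwards [hf.ae_of_comp] with y h1
    exact (hΦ y).exp_le h1 q hq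
  convex {f g} hf hg a b ha hb hab := by
    have hF := hasExpMoments_comp hΦ hmeas hf
    have hG := hasExpMoments_comp hΦ hmeas hg
    refine (hΦ'.mono (hasExpMoments_comp hΦ hmeas ((hf.const_mul a).add (hg.const_mul b)))
      ((hF.const_mul a).add (hG.const_mul b)) ?_).trans (hΦ'.convex hF hG a b ha hb hab)
    filter_upwards [hf.ae_of_comp, hg.ae_of_comp] with y h1 h2
    exact (hΦ y).convex h1 h2 a b ha hb hab
  tendsto {f g} hf hg hm ht := by
    have h1 : ∀ᵐ y ∂ν, ∀ n, HasExpMoments (κ y) (f n) := ae_all_iff.2 fun n => (hf n).ae_of_comp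
    refine hΦ'.tendsto (fun n => hasExpMoments_comp hΦ hmeas (hf n))
      (hasExpMoments_comp hΦ hmeas hg) ?_ ?_
    · filter_upwards [h1, Measure.ae_ae_of_ae_comp hm] with y h1 h2 i j hij
      exact (hΦ y).mono (h1 i) (h1 j) (h2.mono fun x hx => hx hij)
    · filter_upwards [h1, hg.ae_of_comp, Measure.ae_ae_of_ae_comp hm,
        Measure.ae_ae_of_ae_comp ht] with y h1 h2 h3 h4
      exact (hΦ y).tendsto h1 h2 h3 h4

end Composition

end CertaintyEquiv

/-! ### Orlicz hearts of a finite measure -/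

section OrliczHeart

variable {X : Type*} [MeasurableSpace X] {μ : Measure X} [IsFiniteMeasure μ] {f : X → ℝ} {r s : ℝ}

theorem mem_orliczHeart_iff : f ∈ orliczHeart μ r ↔
    Measurable f ∧ ∀ c : ℝ, 0 < c → Integrable (fun x => Real.exp ((|f x| / c) ^ r)) μ := by
  refine and_congr_right fun _ => forall_congr' fun c => imp_congr_right fun _ => ?_
  refine ⟨fun h => ?_, fun h => h.sub (integrable_const 1)⟩
  exact (h.add (integrable_const 1)).congr (ae_of_all _ fun x => by simp [youngExp])

theorem measurable_exp_rpow (hf : Measurable f) (c r : ℝ) :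
    Measurable fun x => Real.exp ((|f x| / c) ^ r) := by
  have : Measurable fun x => |f x| := by simpa using hf.norm
  fun_prop

/-- The integrand decreases in `c`, so only small scales matter; the drift estimate is available
only there. -/
theorem mem_orliczHeart_of_le (hr : 0 ≤ r) (hf : Measurable f) {c₀ : ℝ} (hc₀ : 0 < c₀)
    (h : ∀ c : ℝ, 0 < c → c ≤ c₀ → Integrable (fun x => Real.exp ((|f x| / c) ^ r)) μ) :
    f ∈ orliczHeart μ r := by
  refine mem_orliczHeart_iff.2 ⟨hf, fun c hc => ?_⟩
  refine (h (min c c₀) (lt_min hc hc₀) (min_le_right _ _)).mono'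
    (measurable_exp_rpow hf c r).aestronglyMeasurable (ae_of_all _ fun x => ?_)
  rw [Real.norm_of_nonneg (Real.exp_pos _).le]
  have : 0 < min c c₀ := lt_min hc hc₀
  gcongr
  exact min_le_left _ _

theorem orliczHeart_mono (hs : 0 ≤ s) (hsr : s ≤ r) : orliczHeart μ r ⊆ orliczHeart μ s := by
  intro f hf
  rw [mem_orliczHeart_iff] at hf ⊢
  refine ⟨hf.1, fun c hc => ((hf.2 c hc).const_mul (Real.exp 1)).mono'
    (measurable_exp_rpow hf.1 c s).aestronglyMeasurable (ae_of_all _ fun x => ?_)⟩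
  rw [Real.norm_of_nonneg (Real.exp_pos _).le, ← Real.exp_add, Real.exp_le_exp]
  -- `x ^ s ≤ 1 + x ^ r` for `x ≥ 0`, whence the factor `exp 1`.
  have h0 : 0 ≤ |f x| / c := by positivity
  rcases le_total (|f x| / c) 1 with h | h
  · linarith [Real.rpow_le_one h0 h hs, Real.rpow_nonneg h0 r]
  · linarith [Real.rpow_le_rpow_of_exponent_le h hsr]

theorem HasExpMoments.of_mem_orliczHeart (hr : 1 ≤ r) (hf : f ∈ orliczHeart μ r) :
    HasExpMoments μ f := by
  have h := mem_orliczHeart_iff.1 (orliczHeart_mono zero_le_one hr hf)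
  refine .of_exp_mul_abs h.1 fun n => ?_
  refine (h.2 (1 / (n + 1)) (by positivity)).mono' ?_ (ae_of_all _ fun x => ?_)
  · have : Measurable fun x => |f x| := by simpa using h.1.norm
    exact (this.const_mul _).exp.aestronglyMeasurable
  · rw [Real.norm_of_nonneg (Real.exp_pos _).le, Real.rpow_one, Real.exp_le_exp, div_div_eq_mul_div,
      div_one]
    nlinarith [abs_nonneg (f x)]

theorem HasExpMoments.mem_orliczHeart_one (hf : HasExpMoments μ f) : f ∈ orliczHeart μ 1 := by
  refine mem_orliczHeart_iff.2 ⟨hf.1, fun c _ => ?_⟩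
  simpa [div_eq_inv_mul] using hf.abs.2 c⁻¹

theorem const_mul_mem_orliczHeart (hf : f ∈ orliczHeart μ r) (hr : 0 < r) (a : ℝ) :
    (fun x => a * f x) ∈ orliczHeart μ r := by
  rw [mem_orliczHeart_iff] at hf ⊢
  refine ⟨hf.1.const_mul a, fun c hc => ?_⟩
  rcases eq_or_ne a 0 with rfl | ha
  · simp [Real.zero_rpow hr.ne']
  · have := hf.2 (c / |a|) (by positivity)
    simpa only [abs_mul, div_div_eq_mul_div, mul_comm] using this

theorem abs_mem_orliczHeart (hf : f ∈ orliczHeart μ r) : (fun x => |f x|) ∈ orliczHeart μ r := by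
  rw [mem_orliczHeart_iff] at hf ⊢
  exact ⟨by simpa using hf.1.norm, by simpa using hf.2⟩

theorem neg_mem_orliczHeart (hf : f ∈ orliczHeart μ r) : (fun x => -f x) ∈ orliczHeart μ r := by
  rw [mem_orliczHeart_iff] at hf ⊢
  exact ⟨hf.1.neg, by simpa using hf.2⟩

theorem mem_orliczHeart_map {Y : Type*} [MeasurableSpace Y] {φ : X → Y} (hφ : Measurable φ)
    {g : Y → ℝ} (hg : Measurable g) :
    g ∈ orliczHeart (μ.map φ) r ↔ (fun x => g (φ x)) ∈ orliczHeart μ r := by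
  rw [mem_orliczHeart_iff, mem_orliczHeart_iff]
  refine and_congr ⟨fun h => h.comp hφ, fun _ => hg⟩ (forall_congr' fun c =>
    imp_congr_right fun _ => ?_)
  rw [integrable_map_measure (measurable_exp_rpow hg c r).aestronglyMeasurable hφ.aemeasurable]
  rfl

end OrliczHeart

/-! ### A Jensen inequality for `exp (x ^ s)` -/

/-- Bernoulli's inequality at `x / t - 1`, scaled by `t ^ s`. -/
theorem rpow_tangent_le {t x s : ℝ} (ht : 0 < t) (hx : 0 ≤ x) (hs : 1 ≤ s) :
    t ^ s + s * t ^ (s - 1) * (x - t) ≤ x ^ s := by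
  have h := one_add_mul_self_le_rpow_one_add (s := x / t - 1) (by linarith [div_nonneg hx ht.le]) hs
  rw [add_sub_cancel, Real.div_rpow hx ht.le, le_div_iff₀ (by positivity)] at h
  refine le_trans (le_of_eq ?_) h
  rw [Real.rpow_sub_one ht.ne']
  field_simp

theorem exp_rpow_convex {a x y s : ℝ} (ha : 0 ≤ a) (ha' : a ≤ 1) (hx : 0 ≤ x) (hy : 0 ≤ y)
    (hs : 1 ≤ s) : Real.exp ((a * x + (1 - a) * y) ^ s) ≤
      a * Real.exp (x ^ s) + (1 - a) * Real.exp (y ^ s) := by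
  have h1 := (convexOn_rpow hs).2 hx hy ha (sub_nonneg.2 ha') (by ring)
  have h2 := convexOn_exp.2 (Set.mem_univ (x ^ s)) (Set.mem_univ (y ^ s)) ha (sub_nonneg.2 ha')
    (by ring)
  simp only [smul_eq_mul] at h1 h2
  exact (Real.exp_le_exp.2 h1).trans h2

/-- Replacing `x ^ s` by its tangent at `|Φ h| / c` leaves a plain exponential in `|h|`, to which
`exp_le` applies. The slope varies with `|Φ h|`, which is why `exp_le` is required for all `q ≥ p`.
The right side may be infinite, hence the lower integral. -/
theorem CertaintyEquiv.exp_rpow_le {X : Type*} [MeasurableSpace X] {m : Measure X} {p : ℝ}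
    {Φ : (X → ℝ) → ℝ} (hΦ : CertaintyEquiv m p Φ) {h : X → ℝ} (hh : HasExpMoments m h)
    {s c : ℝ} (hs : 1 ≤ s) (hc : 0 < c) (hc1 : c ≤ 1) (hpc : p * c ≤ 1) :
    ENNReal.ofReal (Real.exp ((|Φ h| / c) ^ s)) ≤ ENNReal.ofReal (Real.exp ((1 / c) ^ s)) +
      ∫⁻ x, ENNReal.ofReal (Real.exp ((|h x| / c) ^ s)) ∂m := by
  -- If `|Φ h| ≤ 1` the slope may fall below `p`; the additive constant absorbs this case.
  rcases le_total |Φ h| 1 with hle | hge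
  · refine le_add_right (ENNReal.ofReal_le_ofReal ?_)
    gcongr
  refine le_add_left ?_
  set t := |Φ h| / c with ht
  have hct : c * t = |Φ h| := mul_div_cancel₀ _ hc.ne'
  have ht1 : 1 ≤ t := (one_le_div hc).2 (hc1.trans hge)
  have ht0 : 0 < t := zero_lt_one.trans_le ht1
  -- The derivative of `(x / c) ^ s` at `x = |Φ h|`; it is at least `1 / c ≥ p` because `t ≥ 1`.
  set q := s * t ^ (s - 1) / c with hq
  have hpq : p ≤ q := by
    rw [hq, le_div_iff₀ hc]
    nlinarith [Real.one_le_rpow ht1 (sub_nonneg.2 hs)]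
  have hq0 : 0 ≤ q := by positivity
  have hb := hΦ.exp_mul_abs_le hh hpq hq0
  have hint : Integrable (fun x => Real.exp (t ^ s - q * |Φ h|) * Real.exp (q * |h x|)) m :=
    (hh.abs.2 q).const_mul _
  calc ENNReal.ofReal (Real.exp (t ^ s))
      ≤ ENNReal.ofReal (∫ x, Real.exp (t ^ s - q * |Φ h|) * Real.exp (q * |h x|) ∂m) := by
        refine ENNReal.ofReal_le_ofReal ?_
        rw [integral_const_mul]
        calc Real.exp (t ^ s) = Real.exp (t ^ s - q * |Φ h|) * Real.exp (q * |Φ h|) := by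
              rw [← Real.exp_add]; ring_nf
          _ ≤ _ := by gcongr
    _ = ∫⁻ x, ENNReal.ofReal (Real.exp (t ^ s - q * |Φ h|) * Real.exp (q * |h x|)) ∂m :=
        ofReal_integral_eq_lintegral_ofReal hint (ae_of_all _ fun x => by positivity)
    _ ≤ _ := by
        refine lintegral_mono fun x => ENNReal.ofReal_le_ofReal ?_
        rw [← Real.exp_add, Real.exp_le_exp]
        refine le_trans (le_of_eq ?_) (rpow_tangent_le ht0 (by positivity : 0 ≤ |h x| / c) hs)
        rw [← hct, hq]
        field_simp
        ring

/-! ### Recursive operators and the drift estimate -/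

/-- `T f s = β Φ_s (f ∘ upd s + w)` for certainty equivalents `Φ_s` under the transition kernel
`N` whose image under the updating rule leaves `μ` invariant. -/
structure RecursiveOperator {F S : Type*} [MeasurableSpace F] [MeasurableSpace S] (μ : Measure S)
    (N : Kernel S F) (upd : S → F → S) (β p : ℝ) (w : F → ℝ) (Φ : S → (F → ℝ) → ℝ)
    (T : (S → ℝ) → S → ℝ) : Prop where
  beta_pos : 0 < β
  beta_lt_one : β < 1
  measurable_upd : Measurable (fun x : S × F => upd x.1 x.2)
  invariant : (μ ⊗ₘ N).map (fun x : S × F => upd x.1 x.2) = μ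
  certaintyEquiv : ∀ s, CertaintyEquiv (N s) p (Φ s)
  eq : ∀ f s, T f s = β * Φ s (fun y => f (upd s y) + w y)
  measurable : ∀ f, Measurable f → Measurable (T f)

namespace RecursiveOperator

variable {F S : Type*} [MeasurableSpace F] [MeasurableSpace S] {μ : Measure S}
  [IsProbabilityMeasure μ] {N : Kernel S F} [IsMarkovKernel N] {upd : S → F → S} {β p : ℝ}
  {w : F → ℝ} {Φ : S → (F → ℝ) → ℝ} {T : (S → ℝ) → S → ℝ} {f g : S → ℝ}

theorem ae_ae_upd (hT : RecursiveOperator μ N upd β p w Φ T) {Q : S → Prop}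
    (hQ : ∀ᵐ s ∂μ, Q s) : ∀ᵐ s ∂μ, ∀ᵐ y ∂(N s), Q (upd s y) := by
  rw [← hT.invariant] at hQ
  exact Measure.ae_ae_of_ae_compProd (ae_of_ae_map hT.measurable_upd.aemeasurable hQ)

theorem hasExpMoments_next (hT : RecursiveOperator μ N upd β p w Φ T)
    (hw : HasExpMoments (N ∘ₘ μ) w) (hf : HasExpMoments μ f) :
    ∀ᵐ s ∂μ, HasExpMoments (N s) (fun y => f (upd s y) + w y) := by
  rw [← hT.invariant] at hf
  rw [← Measure.snd_compProd] at hw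
  exact ((hf.of_map hT.measurable_upd).add (hw.of_map measurable_snd)).ae_of_compProd

theorem mono (hT : RecursiveOperator μ N upd β p w Φ T)
    (hw : HasExpMoments (N ∘ₘ μ) w) (hf : HasExpMoments μ f) (hg : HasExpMoments μ g)
    (hfg : f ≤ᵐ[μ] g) : T f ≤ᵐ[μ] T g := by
  filter_upwards [hT.hasExpMoments_next hw hf, hT.hasExpMoments_next hw hg, hT.ae_ae_upd hfg]
    with s h1 h2 h3
  rw [hT.eq, hT.eq]
  have := hT.beta_pos
  gcongr
  exact (hT.certaintyEquiv s).mono h1 h2 (h3.mono fun y hy => by simpa using hy)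

theorem convex (hT : RecursiveOperator μ N upd β p w Φ T)
    (hw : HasExpMoments (N ∘ₘ μ) w) (hf : HasExpMoments μ f) (hg : HasExpMoments μ g)
    {a b : ℝ} (ha : 0 ≤ a) (hb : 0 ≤ b) (hab : a + b = 1) :
    ∀ᵐ s ∂μ, T (fun x => a * f x + b * g x) s ≤ a * T f s + b * T g s := by
  filter_upwards [hT.hasExpMoments_next hw hf, hT.hasExpMoments_next hw hg] with s h1 h2
  have h3 := (hT.certaintyEquiv s).convex h1 h2 a b ha hb hab
  have h4 : (fun y => a * (f (upd s y) + w y) + b * (g (upd s y) + w y)) =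
      fun y => a * f (upd s y) + b * g (upd s y) + w y := by
    funext y
    linear_combination w y * hab
  rw [h4] at h3
  rw [hT.eq, hT.eq, hT.eq]
  have := mul_le_mul_of_nonneg_left h3 hT.beta_pos.le
  linarith

/-- Write `β (|f| + |w|) / c` as the convex combination, with weights `β` and `1 - β`, of `|f| / c`
and `β |w| / (c (1 - β))`. Convexity of `exp (x ^ s)` separates the two, and invariance turns the
expectation of the updated `f` back into an integral against `μ`. -/
theorem integral_exp_rpow_le (hT : RecursiveOperator μ N upd β p w Φ T) {s : ℝ} (hs : 1 ≤ s)
    (hw : w ∈ orliczHeart (N ∘ₘ μ) s) (hf : f ∈ orliczHeart μ s) {c : ℝ} (hc : 0 < c)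
    (hc1 : c ≤ β) (hpc : p * c ≤ β) :
    Integrable (fun x => Real.exp ((|T f x| / c) ^ s)) μ ∧
    ∫ x, Real.exp ((|T f x| / c) ^ s) ∂μ ≤ Real.exp ((β / c) ^ s) +
      (β * ∫ x, Real.exp ((|f x| / c) ^ s) ∂μ +
        (1 - β) * ∫ y, Real.exp ((|w y| / (c * (1 - β) / β)) ^ s) ∂(N ∘ₘ μ)) := by
  have hβ := hT.beta_pos
  have hβ1 : 0 < 1 - β := sub_pos.2 hT.beta_lt_one
  have hwE := HasExpMoments.of_mem_orliczHeart hs hw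
  have hfE := HasExpMoments.of_mem_orliczHeart hs hf
  have hfI := (mem_orliczHeart_iff.1 hf).2 c hc
  have hwI := (mem_orliczHeart_iff.1 hw).2 (c * (1 - β) / β) (by positivity)
  set If := ∫ x, Real.exp ((|f x| / c) ^ s) ∂μ with hIf
  set Iw := ∫ y, Real.exp ((|w y| / (c * (1 - β) / β)) ^ s) ∂(N ∘ₘ μ) with hIw
  let G : S × F → ℝ := fun x => β * Real.exp ((|f (upd x.1 x.2)| / c) ^ s) +
    (1 - β) * Real.exp ((|w x.2| / (c * (1 - β) / β)) ^ s)
  have hG0 : ∀ x, 0 ≤ G x := fun x => by positivity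
  have hGm : Measurable G :=
    ((measurable_exp_rpow (hfE.1.comp hT.measurable_upd) c s).const_mul β).add
      ((measurable_exp_rpow (hwE.1.comp measurable_snd) _ s).const_mul (1 - β))
  have hG1 : Integrable (fun x : S × F => Real.exp ((|f (upd x.1 x.2)| / c) ^ s)) (μ ⊗ₘ N) := by
    rw [← hT.invariant] at hfI
    exact hfI.comp_measurable hT.measurable_upd
  have hG2 : Integrable (fun x : S × F => Real.exp ((|w x.2| / (c * (1 - β) / β)) ^ s))
      (μ ⊗ₘ N) := by
    rw [← Measure.snd_compProd] at hwI
    exact hwI.comp_measurable measurable_snd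
  have hGI : Integrable G (μ ⊗ₘ N) := (hG1.const_mul β).add (hG2.const_mul (1 - β))
  have hGint : ∫ x, G x ∂(μ ⊗ₘ N) = β * If + (1 - β) * Iw := by
    rw [integral_add (hG1.const_mul β) (hG2.const_mul (1 - β)), integral_const_mul,
      integral_const_mul]
    congr 2
    · rw [hIf]
      conv_rhs => rw [← hT.invariant]
      rw [integral_map hT.measurable_upd.aemeasurable
        (measurable_exp_rpow hfE.1 c s).aestronglyMeasurable]
    · rw [hIw, ← Measure.snd_compProd, Measure.snd, integral_map measurable_snd.aemeasurable
        (measurable_exp_rpow hwE.1 _ s).aestronglyMeasurable]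
  have hlin : ∫⁻ x, ENNReal.ofReal (Real.exp ((|T f x| / c) ^ s)) ∂μ ≤
      ENNReal.ofReal (Real.exp ((β / c) ^ s) + (β * If + (1 - β) * Iw)) := by
    calc ∫⁻ x, ENNReal.ofReal (Real.exp ((|T f x| / c) ^ s)) ∂μ
        ≤ ∫⁻ x, (ENNReal.ofReal (Real.exp ((β / c) ^ s)) +
            ∫⁻ y, ENNReal.ofReal (G (x, y)) ∂(N x)) ∂μ := by
          refine lintegral_mono_ae ?_
          filter_upwards [hT.hasExpMoments_next hwE hfE] with x hx
          -- The outer factor `β` is moved into the scale: `|T f| / c = |Φ| / (c / β)`.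
          have h1 := (hT.certaintyEquiv x).exp_rpow_le hx hs (c := c / β) (by positivity)
            ((div_le_one hβ).2 hc1) (by rw [← mul_div_assoc]; exact (div_le_one hβ).2 hpc)
          rw [one_div_div] at h1
          have h2 : |T f x| / c = |Φ x fun y => f (upd x y) + w y| / (c / β) := by
            rw [hT.eq, abs_mul, abs_of_pos hβ]; field_simp
          rw [h2]
          refine h1.trans (add_le_add le_rfl (lintegral_mono fun y => ENNReal.ofReal_le_ofReal ?_))
          refine le_trans ?_ (exp_rpow_convex hβ.le hT.beta_lt_one.le
            (by positivity : 0 ≤ |f (upd x y)| / c)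
            (by positivity : 0 ≤ |w y| / (c * (1 - β) / β)) hs)
          gcongr
          calc |f (upd x y) + w y| / (c / β) ≤ (|f (upd x y)| + |w y|) / (c / β) := by
                gcongr; exact abs_add_le _ _
            _ = _ := by field_simp
      _ = ENNReal.ofReal (Real.exp ((β / c) ^ s)) + ∫⁻ x, ENNReal.ofReal (G x) ∂(μ ⊗ₘ N) := by
          rw [lintegral_add_left measurable_const, lintegral_const, measure_univ, mul_one,
            Measure.lintegral_compProd hGm.ennreal_ofReal]
      _ = _ := by
          rw [← ofReal_integral_eq_lintegral_ofReal hGI (ae_of_all _ hG0), hGint,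
            ← ENNReal.ofReal_add (Real.exp_pos _).le]
          rw [← hGint]
          exact integral_nonneg hG0
  have hm := measurable_exp_rpow (hT.measurable f hfE.1) c s
  refine ⟨⟨hm.aestronglyMeasurable, ?_⟩, ?_⟩
  · rw [hasFiniteIntegral_iff_ofReal (ae_of_all _ fun x => (Real.exp_pos _).le)]
    exact hlin.trans_lt ENNReal.ofReal_lt_top
  · rw [integral_eq_lintegral_of_nonneg_ae (ae_of_all _ fun x => (Real.exp_pos _).le)
      hm.aestronglyMeasurable]
    refine ENNReal.toReal_le_of_le_ofReal ?_ hlin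
    have : 0 ≤ β * If + (1 - β) * Iw := hGint ▸ integral_nonneg hG0
    positivity

end RecursiveOperator

/-! ### Fatou bounds -/

theorem lintegral_liminf_ofReal_le {X : Type*} [MeasurableSpace X] {μ : Measure X}
    {g : ℕ → X → ℝ} (hm : ∀ n, Measurable (g n)) (hi : ∀ n, Integrable (g n) μ)
    (h0 : ∀ n x, 0 ≤ g n x) {M : ℝ} (hM : ∀ n, ∫ x, g n x ∂μ ≤ M) :
    ∫⁻ x, liminf (fun n => ENNReal.ofReal (g n x)) atTop ∂μ ≤ ENNReal.ofReal M := by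
  refine (lintegral_liminf_le fun n => (hm n).ennreal_ofReal).trans ?_
  refine liminf_le_of_frequently_le' (Frequently.of_forall fun n => ?_)
  rw [← ofReal_integral_eq_lintegral_ofReal (hi n) (ae_of_all _ (h0 n))]
  exact ENNReal.ofReal_le_ofReal (hM n)

theorem ae_not_tendsto_atTop_of_integral_le {X : Type*} [MeasurableSpace X] {μ : Measure X}
    {f : ℕ → X → ℝ} {s c : ℝ} (hs : 1 ≤ s) (hc : 0 < c) (hm : ∀ n, Measurable (f n))
    (hi : ∀ n, Integrable (fun x => Real.exp ((|f n x| / c) ^ s)) μ) {M : ℝ}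
    (hM : ∀ n, ∫ x, Real.exp ((|f n x| / c) ^ s) ∂μ ≤ M) :
    ∀ᵐ x ∂μ, ¬ Tendsto (fun n => f n x) atTop atTop := by
  have h := lintegral_liminf_ofReal_le (fun n => measurable_exp_rpow (hm n) c s) hi
    (fun n x => (Real.exp_pos _).le) hM
  filter_upwards [ae_lt_top (.liminf fun n => (measurable_exp_rpow (hm n) c s).ennreal_ofReal)
    (h.trans_lt ENNReal.ofReal_lt_top).ne] with x hx ht
  refine hx.ne (Tendsto.liminf_eq ?_)
  refine ENNReal.tendsto_ofReal_atTop.comp (Real.tendsto_exp_atTop.comp ?_)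
  exact (tendsto_rpow_atTop (zero_lt_one.trans_le hs)).comp
    ((tendsto_abs_atTop_atTop.comp ht).atTop_div_const hc)

/-! ### Existence and uniqueness of fixed points -/

namespace RecursiveOperator

variable {F S : Type*} [MeasurableSpace F] [MeasurableSpace S] {μ : Measure S}
  [IsProbabilityMeasure μ] {N : Kernel S F} [IsMarkovKernel N] {upd : S → F → S} {β p : ℝ}
  {w : F → ℝ} {Φ : S → (F → ℝ) → ℝ} {T : (S → ℝ) → S → ℝ} {f g : S → ℝ}

theorem exists_scale (hβ : 0 < β) (p : ℝ) :
    ∃ c₀ : ℝ, 0 < c₀ ∧ ∀ c, 0 < c → c ≤ c₀ → c ≤ β ∧ p * c ≤ β := by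
  refine ⟨β / (1 + |p|), by positivity, fun c hc h => ?_⟩
  rw [le_div_iff₀ (by positivity)] at h
  constructor <;> nlinarith [abs_nonneg p, le_abs_self p, mul_nonneg hc.le (abs_nonneg p)]

theorem map_mem_orliczHeart (hT : RecursiveOperator μ N upd β p w Φ T) {s : ℝ} (hs : 1 ≤ s)
    (hw : w ∈ orliczHeart (N ∘ₘ μ) s) (hf : f ∈ orliczHeart μ s) : T f ∈ orliczHeart μ s := by
  obtain ⟨c₀, hc₀, h⟩ := exists_scale hT.beta_pos p
  refine mem_orliczHeart_of_le (zero_le_one.trans hs) (hT.measurable f hf.1) hc₀ fun c hc hcc => ?_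
  exact (hT.integral_exp_rpow_le hs hw hf hc (h c hc hcc).1 (h c hc hcc).2).1

/-- The iterates increase almost everywhere. The drift bounds their Orlicz integrals, so they cannot
diverge, and Fatou places the limit in the same heart. Monotone continuity of `Φ` makes the limit a
fixed point. -/
theorem exists_fixedPoint_of_subsolution (hT : RecursiveOperator μ N upd β p w Φ T) {r : ℝ}
    (hr : 1 ≤ r) (hw : w ∈ orliczHeart (N ∘ₘ μ) r) (hf : f ∈ orliczHeart μ r)
    (hsub : f ≤ᵐ[μ] T f) : ∃ v ∈ orliczHeart μ r, T v =ᵐ[μ] v := by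
  have hwE := HasExpMoments.of_mem_orliczHeart hr hw
  set a : ℕ → S → ℝ := fun n => T^[n] f with ha
  have ha1 : ∀ n, a (n + 1) = T (a n) := fun n => Function.iterate_succ_apply' T n f
  have hmem : ∀ n, a n ∈ orliczHeart μ r := fun n => by
    induction n with
    | zero => exact hf
    | succ n ih => rw [ha1]; exact hT.map_mem_orliczHeart hr hw ih
  have hE : ∀ n, HasExpMoments μ (a n) := fun n => .of_mem_orliczHeart hr (hmem n)
  have hstep : ∀ n, a n ≤ᵐ[μ] a (n + 1) := fun n => by
    induction n with
    | zero => exact hsub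
    | succ n ih =>
      have := hT.mono hwE (hE n) (hE (n + 1)) ih
      rwa [← ha1, ← ha1] at this
  have hmono : ∀ᵐ x ∂μ, Monotone fun n => a n x := by
    filter_upwards [ae_all_iff.2 hstep] with x hx using monotone_nat_of_le_succ hx
  obtain ⟨c₀, hc₀, hscale⟩ := exists_scale hT.beta_pos p
  have hbound : ∀ c : ℝ, 0 < c → c ≤ c₀ → ∃ M : ℝ, ∀ n,
      ∫ x, Real.exp ((|a n x| / c) ^ r) ∂μ ≤ M := by
    intro c hc hcc
    set I₀ := ∫ x, Real.exp ((|f x| / c) ^ r) ∂μ with hI₀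
    set D := Real.exp ((β / c) ^ r) +
      (1 - β) * ∫ y, Real.exp ((|w y| / (c * (1 - β) / β)) ^ r) ∂(N ∘ₘ μ) with hD
    have hβ := hT.beta_pos
    have hβ1 : 0 < 1 - β := sub_pos.2 hT.beta_lt_one
    have hI₀' : 0 ≤ I₀ := integral_nonneg fun x => (Real.exp_pos _).le
    have hD0 : 0 ≤ D := add_nonneg (Real.exp_pos _).le
      (mul_nonneg hβ1.le (integral_nonneg fun x => (Real.exp_pos _).le))
    -- `D / (1 - β)` is the fixed point of `x ↦ D + β x`; adding `I₀` covers the start of the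
    -- induction.
    refine ⟨I₀ + D / (1 - β), fun n => ?_⟩
    induction n with
    | zero => exact le_add_of_nonneg_right (by positivity)
    | succ n ih =>
      have h := (hT.integral_exp_rpow_le hr hw (hmem n) hc (hscale c hc hcc).1
        (hscale c hc hcc).2).2
      rw [← ha1] at h
      have h1 := mul_le_mul_of_nonneg_left ih hβ.le
      have h2 : D + β * (D / (1 - β)) = D / (1 - β) := by field_simp; ring
      nlinarith
  have hint : ∀ n c, 0 < c → Integrable (fun x => Real.exp ((|a n x| / c) ^ r)) μ :=
    fun n c hc => (mem_orliczHeart_iff.1 (hmem n)).2 c hc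
  obtain ⟨M, hM⟩ := hbound c₀ hc₀ le_rfl
  have hconv : ∀ᵐ x ∂μ, ∃ l, Tendsto (fun n => a n x) atTop (𝓝 l) := by
    filter_upwards [hmono, ae_not_tendsto_atTop_of_integral_le hr hc₀ (fun n => (hmem n).1)
      (fun n => hint n c₀ hc₀) hM] with x hx hnt
    exact (tendsto_atTop_of_monotone hx).resolve_left hnt
  obtain ⟨v, hv, hlim⟩ := measurable_limit_of_tendsto_metrizable_ae
    (fun n => (hmem n).1.aemeasurable) hconv
  have hvmem : v ∈ orliczHeart μ r := by
    refine mem_orliczHeart_of_le (zero_le_one.trans hr) hv hc₀ fun c hc hcc => ?_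
    obtain ⟨M, hM⟩ := hbound c hc hcc
    have h := lintegral_liminf_ofReal_le (fun n => measurable_exp_rpow (hmem n).1 c r)
      (fun n => hint n c hc) (fun n x => (Real.exp_pos _).le) hM
    refine ⟨(measurable_exp_rpow hv c r).aestronglyMeasurable, ?_⟩
    rw [hasFiniteIntegral_iff_ofReal (ae_of_all _ fun x => (Real.exp_pos _).le)]
    refine lt_of_le_of_lt (le_of_eq (lintegral_congr_ae ?_)) (h.trans_lt ENNReal.ofReal_lt_top)
    filter_upwards [hlim] with x hx
    refine (Tendsto.liminf_eq ?_).symm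
    refine ENNReal.tendsto_ofReal ((Tendsto.rpow_const (hx.abs.div_const c) ?_).rexp)
    exact .inr (zero_le_one.trans hr)
  refine ⟨v, hvmem, ?_⟩
  have hvE := HasExpMoments.of_mem_orliczHeart hr hvmem
  filter_upwards [ae_all_iff.2 fun n => hT.hasExpMoments_next hwE (hE n),
    hT.hasExpMoments_next hwE hvE, hT.ae_ae_upd hmono, hT.ae_ae_upd hlim, hlim]
    with x h1 h2 h3 h4 h5
  have h6 := (hT.certaintyEquiv x).tendsto h1 h2
    (h3.mono fun y hy i j hij => by simpa using hy hij) (h4.mono fun y hy => hy.add_const _)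
  have h7 : Tendsto (fun n => a (n + 1) x) atTop (𝓝 (T v x)) := by
    simp only [ha1, hT.eq]
    exact h6.const_mul β
  exact tendsto_nhds_unique h7 (h5.comp (tendsto_add_atTop_nat 1))

theorem exists_fixedPoint (hT : RecursiveOperator μ N upd β p w Φ T) {r : ℝ} (hr : 1 ≤ r)
    (hw : w ∈ orliczHeart (N ∘ₘ μ) r) : ∃ v ∈ orliczHeart μ r, T v =ᵐ[μ] v := by
  have hwE := HasExpMoments.of_mem_orliczHeart hr hw
  have hw' := abs_mem_orliczHeart hw
  -- The linear operator with the mean and `|w|` is of the same kind, and `0` is a subsolution for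
  -- it.
  have hL : RecursiveOperator μ N upd β p (fun y => |w y|) (fun s h => ∫ y, h y ∂(N s))
      (fun f s => β * ∫ y, (f (upd s y) + |w y|) ∂(N s)) :=
    { beta_pos := hT.beta_pos
      beta_lt_one := hT.beta_lt_one
      measurable_upd := hT.measurable_upd
      invariant := hT.invariant
      certaintyEquiv := fun s => .mean p
      eq := fun f s => rfl
      measurable := fun f hf => by
        refine Measurable.const_mul (StronglyMeasurable.measurable ?_) β
        refine StronglyMeasurable.integral_kernel_prod_right
          (f := fun s y => f (upd s y) + |w y|) (Measurable.stronglyMeasurable ?_)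
        exact (hf.comp hT.measurable_upd).add (hwE.abs.1.comp measurable_snd) }
  have h0 : (fun _ => (0 : ℝ)) ∈ orliczHeart μ r := mem_orliczHeart_iff.2
    ⟨measurable_const, fun c _ => by simp⟩
  obtain ⟨a, ha, haT⟩ := hL.exists_fixedPoint_of_subsolution hr hw' h0
    (ae_of_all _ fun s => mul_nonneg hT.beta_pos.le (integral_nonneg fun y => by simp))
  have haE := HasExpMoments.of_mem_orliczHeart hr ha
  -- With `a = β E[a ∘ upd + |w|]`, one has `-a ≤ β E[-a ∘ upd + w] ≤ T (-a)`, since `Φ` dominates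
  -- the mean.
  refine hT.exists_fixedPoint_of_subsolution hr hw (neg_mem_orliczHeart ha) ?_
  filter_upwards [haT, hT.hasExpMoments_next hwE haE.neg, hL.hasExpMoments_next hwE.abs haE]
    with s h1 h2 h3
  rw [← h1, hT.eq, ← mul_neg, ← integral_neg]
  refine mul_le_mul_of_nonneg_left ?_ hT.beta_pos.le
  refine le_trans (integral_mono h3.neg.integrable h2.integrable fun y => ?_)
    ((hT.certaintyEquiv s).mean_le h2)
  simp only
  linarith [neg_abs_le (w y)]

/-- Bounded exponential moments along `n` are incompatible with `z n → ∞` on a set of positive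
measure, so `f > g` has measure zero. Working at exponent one covers every `s` at once. -/
theorem le_of_isFixedPt (hT : RecursiveOperator μ N upd β p w Φ T)
    (hw : HasExpMoments (N ∘ₘ μ) w) (hf : HasExpMoments μ f) (hg : HasExpMoments μ g)
    (hTf : T f =ᵐ[μ] f) (hTg : T g =ᵐ[μ] g) : f ≤ᵐ[μ] g := by
  -- `z n = g + (n + 1) (f - g)` is a subsolution, so its exponential moments are bounded in `n`.
  set z : ℕ → S → ℝ := fun n x => g x + (n + 1) * (f x - g x) with hz
  have hzE : ∀ n, HasExpMoments μ (z n) := fun n => hg.add ((hf.sub hg).const_mul _)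
  -- The drift estimate sees only absolute values; the positive part turns the one-sided `z n ≤ T (z
  -- n)` into such a bound.
  have hsub : ∀ n, ∀ᵐ x ∂μ, |max (z n x) 0| ≤ |T (fun x => max (z n x) 0) x| := fun n => by
    have hn : (0 : ℝ) < n + 1 := by positivity
    have hab : (n : ℝ) / (n + 1) + 1 / (n + 1) = 1 := by field_simp
    -- `f` lies between `g` and `z n`, so convexity of `T` bounds `T (z n)` from below.
    have hcomb : (fun x => (n : ℝ) / (n + 1) * g x + 1 / (n + 1) * z n x) = f := by
      funext x; simp only [hz]; field_simp; ring
    have h1 := hT.convex hw hg (hzE n) (by positivity) (by positivity) hab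
    rw [hcomb] at h1
    filter_upwards [h1, hTf, hTg, hT.mono hw (hzE n) (hzE n).pos_part
      (ae_of_all _ fun x => le_max_left _ _)] with x h1 h2 h3 h4
    rw [abs_of_nonneg (le_max_right _ _)]
    refine max_le ?_ (abs_nonneg _)
    refine le_trans (le_trans ?_ h4) (le_abs_self _)
    rw [h2, h3, ← congrFun hcomb x] at h1
    exact le_of_mul_le_mul_left (by linarith) (by positivity : 0 < 1 / ((n : ℝ) + 1))
  obtain ⟨c, hc, hscale⟩ := exists_scale hT.beta_pos p
  set D := Real.exp ((β / c) ^ (1 : ℝ)) +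
    (1 - β) * ∫ y, Real.exp ((|w y| / (c * (1 - β) / β)) ^ (1 : ℝ)) ∂(N ∘ₘ μ) with hD
  have hβ1 : 0 < 1 - β := sub_pos.2 hT.beta_lt_one
  have hbound : ∀ n, Integrable (fun x => Real.exp ((|max (z n x) 0| / c) ^ (1 : ℝ))) μ ∧
      ∫ x, Real.exp ((|max (z n x) 0| / c) ^ (1 : ℝ)) ∂μ ≤ D / (1 - β) := fun n => by
    have hmem := (hzE n).pos_part.mem_orliczHeart_one
    have hi := (mem_orliczHeart_iff.1 hmem).2 c hc
    obtain ⟨h1, h2⟩ := hT.integral_exp_rpow_le le_rfl hw.mem_orliczHeart_one hmem hc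
      (hscale c hc le_rfl).1 (hscale c hc le_rfl).2
    refine ⟨hi, (le_div_iff₀ hβ1).2 ?_⟩
    -- `I ≤ D + β I` with `I` finite, hence `I ≤ D / (1 - β)` uniformly in `n`.
    have h3 := integral_mono_ae hi h1 ((hsub n).mono fun x hx => by simp only; gcongr)
    linarith
  filter_upwards [ae_not_tendsto_atTop_of_integral_le le_rfl hc (fun n => (hzE n).pos_part.1)
    (fun n => (hbound n).1) (fun n => (hbound n).2)] with x hx
  by_contra! hlt
  refine hx (tendsto_atTop_mono (fun n => le_max_left _ _) ?_)
  refine tendsto_atTop_add_const_left _ _ (Tendsto.atTop_mul_const (sub_pos.2 hlt) ?_)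
  exact tendsto_atTop_add_const_right _ _ tendsto_natCast_atTop_atTop

end RecursiveOperator

/-! ### The predictive law and the invariance of the law of `X̃` -/

instance {F H S : Type*} [MeasurableSpace F] [StandardBorelSpace F]
    [Nonempty F] [MeasurableSpace H] [MeasurableSpace S] (Q₀ : Measure (F × S))
    [IsFiniteMeasure Q₀] (post : Kernel (F × S) H) [IsMarkovKernel post] :
    IsMarkovKernel (postGivenStat Q₀ post) := by
  unfold postGivenStat; infer_instance

/-- Disintegrating `Q₀` over its second coordinate undoes the averaging over `φ`, provided the
integrand does not involve `φ`. -/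
theorem lintegral_postGivenStat {F H S : Type*} [MeasurableSpace F] [StandardBorelSpace F]
    [Nonempty F] [MeasurableSpace H] [MeasurableSpace S] (Q₀ : Measure (F × S))
    [IsFiniteMeasure Q₀] (post : Kernel (F × S) H) [IsMarkovKernel post] {G : S × H → ENNReal}
    (hG : Measurable G) :
    ∫⁻ s, ∫⁻ x, G (s, x) ∂(postGivenStat Q₀ post s) ∂(Q₀.map Prod.snd) =
      ∫⁻ z, ∫⁻ x, G (z.2, x) ∂(post z) ∂Q₀ := by
  have hinner : Measurable fun z : F × S => ∫⁻ x, G (z.2, x) ∂(post z) :=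
    Measurable.lintegral_kernel_prod_right' (f := fun q : (F × S) × H => G (q.1.2, q.2))
      (by fun_prop)
  have h1 : ∀ s, ∫⁻ x, G (s, x) ∂(postGivenStat Q₀ post s) =
      ∫⁻ φ, ∫⁻ x, G (s, x) ∂(post (φ, s)) ∂(condDistrib Prod.fst Prod.snd Q₀ s) := fun s => by
    have hm : Measurable fun z : F × S => ∫⁻ x, G (s, x) ∂(post z) :=
      (hG.comp measurable_prodMk_left).lintegral_kernel
    have hGs : Measurable fun x => G (s, x) := hG.comp measurable_prodMk_left
    rw [postGivenStat, Kernel.lintegral_comp _ _ _ hGs, Kernel.lintegral_prod _ _ _ hm]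
    refine lintegral_congr fun φ => ?_
    have hm' : Measurable fun c => ∫⁻ x, G (s, x) ∂(post (φ, c)) := hm.comp measurable_prodMk_left
    rw [Kernel.lintegral_id' hm']
  simp only [h1]
  have h2 := compProd_map_condDistrib (mβ := inferInstance) (X := (Prod.snd : F × S → S)) (μ := Q₀)
    (Y := (Prod.fst : F × S → F)) measurable_fst.aemeasurable
  have hsw : Measurable fun q : S × F => ∫⁻ x, G (q.1, x) ∂(post (q.2, q.1)) :=
    hinner.comp measurable_swap
  have h3 := Measure.lintegral_compProd (μ := Q₀.map Prod.snd)
    (κ := condDistrib (Prod.fst : F × S → F) Prod.snd Q₀) hsw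
  rw [← h3, h2, lintegral_map hsw (by fun_prop)]

namespace LearningEnvironment

variable {Ω F H S : Type*} [MeasurableSpace Ω] [MeasurableSpace F]
  [MeasurableSpace H] [MeasurableSpace S] {P : Measure Ω} [IsProbabilityMeasure P]
  {obs : ℕ → Ω → F} {hid : ℕ → Ω → H} {stat : ℕ → Ω → S}
  {Qobs : Kernel H F} [IsMarkovKernel Qobs] {Qhid : Kernel H H} [IsMarkovKernel Qhid]
  {post : Kernel (F × S) H} {upd : S → F → S}

theorem lintegral_stat_obs (hS : LearningEnvironment P obs hid stat Qobs Qhid post upd)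
    {G : S × F → ENNReal} (hG : Measurable G) :
    ∫⁻ ω, G (stat 0 ω, obs 1 ω) ∂P = ∫⁻ ω, ∫⁻ y, G (stat 0 ω, y) ∂(Qobs (hid 0 ω)) ∂P := by
  have h := (hS.markov 0).map_eq
  have hobs := hS.measurable_obs
  have hhid := hS.measurable_hid
  have hstat := hS.measurable_stat
  have hhist : Measurable fun ω (i : Fin (0 + 1)) => (obs i ω, hid i ω, stat i ω) := by fun_prop
  have hG' : Measurable fun q : (Fin (0 + 1) → F × H × S) × (F × H) => G ((q.1 0).2.2, q.2.1) := by
    fun_prop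
  have h1 := congrArg (fun m => ∫⁻ q, G ((q.1 0).2.2, q.2.1) ∂m) h
  simp only at h1
  rw [lintegral_map hG' (hhist.prodMk ((hobs _).prodMk (hhid _))), Measure.lintegral_compProd hG',
    lintegral_map (Measurable.lintegral_kernel_prod_right' hG') hhist] at h1
  refine h1.trans (lintegral_congr fun ω => ?_)
  have hm : Measurable fun b : F × H => G (stat 0 ω, b.1) := by fun_prop
  simp only [Kernel.comap_apply, Fin.val_zero, Fin.last_zero]
  rw [Kernel.lintegral_prod _ _ _ hm]
  simp

variable [StandardBorelSpace F] [Nonempty F] [IsMarkovKernel post]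

/-- The Markov property replaces the next observation by a draw from `Qobs` at the hidden state; the
posterior then replaces the hidden state, and averaging over `φ` leaves a kernel of the statistic
alone. -/
theorem map_stat_obs (hS : LearningEnvironment P obs hid stat Qobs Qhid post upd) :
    P.map (fun ω => (stat 0 ω, obs 1 ω)) =
      (P.map (fun ω => (obs 0 ω, stat 0 ω))).map Prod.snd ⊗ₘ
        (Qobs ∘ₖ postGivenStat (P.map (fun ω => (obs 0 ω, stat 0 ω))) post) := by
  have hobs := hS.measurable_obs
  have hhid := hS.measurable_hid
  have hstat := hS.measurable_stat
  have hX : Measurable fun ω => (obs 0 ω, stat 0 ω) := by fun_prop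
  have := Measure.isProbabilityMeasure_map (μ := P) hX.aemeasurable
  refine Measure.ext_of_lintegral _ fun G hG => ?_
  have hG1 : Measurable fun q : S × H => ∫⁻ y, G (q.1, y) ∂(Qobs q.2) :=
    Measurable.lintegral_kernel_prod_right' (κ := Kernel.prodMkLeft S Qobs)
      (f := fun q : (S × H) × F => G (q.1.1, q.2)) (by fun_prop)
  have hpost := congrArg (fun m => ∫⁻ q, ∫⁻ y, G (q.1.2, y) ∂(Qobs q.2) ∂m)
    (hS.posterior 0).map_eq
  have hG2 : Measurable fun q : (F × S) × H => ∫⁻ y, G (q.1.2, y) ∂(Qobs q.2) :=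
    hG1.comp (measurable_fst.snd.prodMk measurable_snd)
  simp only at hpost
  rw [lintegral_map hG2 (hX.prodMk (hhid 0)), Measure.lintegral_compProd hG2] at hpost
  rw [lintegral_map hG (by fun_prop), hS.lintegral_stat_obs hG, hpost,
    Measure.lintegral_compProd hG, ← lintegral_postGivenStat _ post hG1]
  refine lintegral_congr fun s => ?_
  have hGs : Measurable fun y => G (s, y) := hG.comp measurable_prodMk_left
  rw [Kernel.lintegral_comp _ _ _ hGs]

/-- The updated pair is `(φ_1, ξ̃_1)` almost surely, and stationarity gives it the law of `(φ_0,
ξ̃_0)`. -/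
theorem map_obs_upd (hS : LearningEnvironment P obs hid stat Qobs Qhid post upd) :
    ((P.map (fun ω => (obs 0 ω, stat 0 ω))).map Prod.snd ⊗ₘ
      (Qobs ∘ₖ postGivenStat (P.map (fun ω => (obs 0 ω, stat 0 ω))) post)).map
        (fun x : S × F => (x.2, upd x.1 x.2)) = P.map (fun ω => (obs 0 ω, stat 0 ω)) := by
  have hobs := hS.measurable_obs
  have hhid := hS.measurable_hid
  have hstat := hS.measurable_stat
  have hupd := hS.measurable_upd
  rw [← hS.map_stat_obs, Measure.map_map (by fun_prop) (by fun_prop)]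
  have h1 : P.map ((fun x : S × F => (x.2, upd x.1 x.2)) ∘ fun ω => (stat 0 ω, obs 1 ω)) =
      P.map (fun ω => (obs 1 ω, stat 1 ω)) :=
    Measure.map_congr ((hS.update 0).mono fun ω hω => by simp [← hω])
  have h2 := congrArg (Measure.map fun z : ℕ → H × F × S => (z 0).2) (hS.stationary 1)
  rw [Measure.map_map (by fun_prop) (by fun_prop), Measure.map_map (by fun_prop) (by fun_prop)] at h2
  rw [h1]
  exact h2

end LearningEnvironment

theorem mem_orliczHeartStat_iff {F S : Type*} [MeasurableSpace F] [MeasurableSpace S]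
    {Q₀ : Measure (F × S)} [IsFiniteMeasure Q₀] {r : ℝ} {f : S → ℝ} :
    f ∈ orliczHeartStat Q₀ r ↔ f ∈ orliczHeart (Q₀.map Prod.snd) r :=
  ⟨fun h => (mem_orliczHeart_map measurable_snd h.1).2 h.2,
    fun h => ⟨h.1, (mem_orliczHeart_map measurable_snd h.1).1 h⟩⟩

theorem RecursiveOperator.hasUniqueThinTailedFixedPoint {F S : Type*} [MeasurableSpace F]
    [MeasurableSpace S] {Q₀ : Measure (F × S)} [IsProbabilityMeasure Q₀] {N : Kernel S F}
    [IsMarkovKernel N] {upd : S → F → S} {β p : ℝ} {w : F → ℝ} {Φ : S → (F → ℝ) → ℝ}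
    {T : (S → ℝ) → S → ℝ} {D : (S → ℝ) → S → Prop}
    (hT : RecursiveOperator (Q₀.map Prod.snd) N upd β p w Φ T) {r : ℝ} (hr : 1 < r)
    (hw : w ∈ orliczHeart (N ∘ₘ Q₀.map Prod.snd) r)
    (hD : ∀ f s, HasExpMoments (N s) (fun y => f (upd s y) + w y) → D f s) :
    HasUniqueThinTailedFixedPoint Q₀ r T D := by
  have := Measure.isProbabilityMeasure_map (μ := Q₀) measurable_snd.aemeasurable
  have hwE := HasExpMoments.of_mem_orliczHeart hr.le hw
  simp only [HasUniqueThinTailedFixedPoint, mem_orliczHeartStat_iff]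
  refine ⟨fun s hs hsr f hf => ⟨?_, ?_⟩, ?_⟩
  · filter_upwards [hT.hasExpMoments_next hwE (.of_mem_orliczHeart hs hf)] with z hz using hD f z hz
  · exact hT.map_mem_orliczHeart hs (orliczHeart_mono (zero_le_one.trans hs) hsr hw) hf
  · obtain ⟨v, hv, hTv⟩ := hT.exists_fixedPoint hr.le hw
    have hvE := HasExpMoments.of_mem_orliczHeart hr.le hv
    refine ⟨v, hv, hTv, fun s hs hsr => ⟨orliczHeart_mono (zero_le_one.trans hs.le) hsr hv,
      fun g hg hTg => ?_⟩⟩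
    have hgE := HasExpMoments.of_mem_orliczHeart hs.le hg
    exact (hT.le_of_isFixedPt hwE hgE hvE hTg hTv).antisymm
      (hT.le_of_isFixedPt hwE hvE hgE hTv hTg)

/-! ### The two learning functionals as certainty equivalents -/

section Functionals

variable {F H : Type*} [MeasurableSpace F] [MeasurableSpace H] {Q : Kernel H F} {h : F → ℝ}

theorem measurable_entropic (k : ℝ) (hh : Measurable h) :
    Measurable fun x => k⁻¹ * Real.log (∫ y, Real.exp (k * h y) ∂(Q x)) := by
  have : StronglyMeasurable fun y => Real.exp (k * h y) :=
    (Measurable.stronglyMeasurable (by fun_prop))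
  exact (this.integral_kernel (κ := Q)).measurable.log.const_mul _

theorem measurable_mean (hh : Measurable h) : Measurable fun x => ∫ y, h y ∂(Q x) :=
  (hh.stronglyMeasurable.integral_kernel (κ := Q)).measurable

variable [IsMarkovKernel Q] {ν : Measure H} [IsProbabilityMeasure ν] {k : ℝ}

/-- The power `k⁻¹` is the exponential of the inner entropic value wherever the inner integral is
positive, that is, where the exponential is integrable. -/
theorem ae_exp_entropic_eq (hh : HasExpMoments (Q ∘ₘ ν) h) :
    (fun x => Real.exp (1 * (k⁻¹ * Real.log (∫ y, Real.exp (k * h y) ∂(Q x))))) =ᵐ[ν]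
      fun x => (∫ y, Real.exp (k * h y) ∂(Q x)) ^ k⁻¹ := by
  filter_upwards [hh.ae_of_comp] with x hx
  rw [Real.rpow_def_of_pos (integral_exp_pos (hx.2 k)), one_mul, mul_comm]

theorem integrable_rpow_integral_exp (hk : 0 < k) (hh : HasExpMoments (Q ∘ₘ ν) h) :
    Integrable (fun x => (∫ y, Real.exp (k * h y) ∂(Q x)) ^ k⁻¹) ν :=
  ((CertaintyEquiv.hasExpMoments_comp (fun _ => CertaintyEquiv.entropic hk le_rfl)
    (fun _ hf => measurable_entropic k hf) hh).2 1).congr (ae_exp_entropic_eq hh)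

theorem certaintyEquiv_log_integral_rpow (hk : 0 < k) :
    CertaintyEquiv (Q ∘ₘ ν) (max 1 k)
      (fun h => Real.log (∫ x, (∫ y, Real.exp (k * h y) ∂(Q x)) ^ k⁻¹ ∂ν)) := by
  refine ((CertaintyEquiv.entropic zero_lt_one (le_max_left _ _)).comp
    (fun x => CertaintyEquiv.entropic hk (le_max_right _ _))
    (fun _ hf => measurable_entropic k hf)).congr fun h hh => ?_
  rw [inv_one, one_mul, integral_congr_ae (ae_exp_entropic_eq hh)]

theorem integrable_exp_integral (hh : HasExpMoments (Q ∘ₘ ν) h) :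
    Integrable (fun x => Real.exp (∫ y, h y ∂(Q x))) ν := by
  simpa using (CertaintyEquiv.hasExpMoments_comp (fun x => CertaintyEquiv.mean (m := Q x) 1)
    (fun _ hf => measurable_mean hf) hh).2 1

theorem certaintyEquiv_log_integral_exp :
    CertaintyEquiv (Q ∘ₘ ν) 1 (fun h => Real.log (∫ x, Real.exp (∫ y, h y ∂(Q x)) ∂ν)) := by
  refine ((CertaintyEquiv.entropic zero_lt_one le_rfl).comp
    (fun x => CertaintyEquiv.mean 1) (fun _ hf => measurable_mean hf)).congr fun h hh => ?_
  simp

end Functionals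

/-! ### The learning operators as recursive operators -/

section Operators

variable {F H S : Type*} [MeasurableSpace F] [MeasurableSpace H] [MeasurableSpace S]
  {K : Kernel S H} [IsMarkovKernel K] {Q : Kernel H F} [IsMarkovKernel Q] {upd : S → F → S}
  {u : F → ℝ}

theorem measurable_integral_right {G : S × F → ℝ} (hG : Measurable G) :
    Measurable fun q : S × H => ∫ y, G (q.1, y) ∂(Q q.2) := by
  refine (StronglyMeasurable.integral_kernel_prod_right (κ := Kernel.prodMkLeft S Q)
    (f := fun (q : S × H) y => G (q.1, y)) (Measurable.stronglyMeasurable ?_)).measurable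
  exact hG.comp (measurable_fst.fst.prodMk measurable_snd)

/-- Factoring `θ / ϑ` out of the exponent gives `w = (α ϑ / θ) u`. The bound `max 1 (θ / ϑ)` serves
both entropic layers: parameter `1` outside and `θ / ϑ` inside. -/
theorem recursiveOperator_learnOp {μ : Measure S} {β θ ϑ α : ℝ} (hβ₀ : 0 < β) (hβ₁ : β < 1)
    (hθ : 0 < θ) (hϑ : 0 < ϑ) (hupd : Measurable fun x : S × F => upd x.1 x.2)
    (hinv : (μ ⊗ₘ (Q ∘ₖ K)).map (fun x : S × F => upd x.1 x.2) = μ) (hu : Measurable u) :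
    RecursiveOperator μ (Q ∘ₖ K) upd β (max 1 (θ / ϑ)) (fun y => α * ϑ / θ * u y)
      (fun s h => Real.log (∫ x, (∫ y, Real.exp (θ / ϑ * h y) ∂(Q x)) ^ (θ / ϑ)⁻¹ ∂(K s)))
      (learnOp β θ ϑ α K Q upd u) where
  beta_pos := hβ₀
  beta_lt_one := hβ₁
  measurable_upd := hupd
  invariant := hinv
  certaintyEquiv s := certaintyEquiv_log_integral_rpow (by positivity)
  eq f s := by
    have : ∀ y, θ / ϑ * (f (upd s y) + α * ϑ / θ * u y) = θ / ϑ * f (upd s y) + α * u y :=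
      fun y => by field_simp
    simp only [learnOp, this, inv_div]
  measurable f hf := by
    have h1 : Measurable fun q : S × F => Real.exp (θ / ϑ * f (upd q.1 q.2) + α * u q.2) := by
      fun_prop
    have h2 := (measurable_integral_right (Q := Q) h1).pow_const (ϑ / θ)
    exact ((StronglyMeasurable.integral_kernel_prod_right' (κ := K)
      h2.stronglyMeasurable).measurable.log).const_mul β

theorem recursiveOperator_learnOpLim {μ : Measure S} {β α : ℝ} (hβ₀ : 0 < β) (hβ₁ : β < 1)
    (hupd : Measurable fun x : S × F => upd x.1 x.2)
    (hinv : (μ ⊗ₘ (Q ∘ₖ K)).map (fun x : S × F => upd x.1 x.2) = μ) (hu : Measurable u) :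
    RecursiveOperator μ (Q ∘ₖ K) upd β 1 (fun y => α * u y)
      (fun s h => Real.log (∫ x, Real.exp (∫ y, h y ∂(Q x)) ∂(K s)))
      (learnOpLim β α K Q upd u) where
  beta_pos := hβ₀
  beta_lt_one := hβ₁
  measurable_upd := hupd
  invariant := hinv
  certaintyEquiv s := certaintyEquiv_log_integral_exp
  eq f s := rfl
  measurable f hf := by
    have h1 : Measurable fun q : S × F => f (upd q.1 q.2) + α * u q.2 := by fun_prop
    have h2 := (measurable_integral_right (Q := Q) h1).exp
    exact ((StronglyMeasurable.integral_kernel_prod_right' (κ := K)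
      h2.stronglyMeasurable).measurable.log).const_mul β

theorem learnOpDefinedAt_of_hasExpMoments {θ ϑ α : ℝ} (hθ : 0 < θ) (hϑ : 0 < ϑ) {f : S → ℝ}
    {s : S} (h : HasExpMoments ((Q ∘ₖ K) s) fun y => f (upd s y) + α * ϑ / θ * u y) :
    LearnOpDefinedAt θ ϑ α K Q upd u f s := by
  have he : ∀ y, θ / ϑ * (f (upd s y) + α * ϑ / θ * u y) = θ / ϑ * f (upd s y) + α * u y :=
    fun y => by field_simp
  rw [Kernel.comp_apply] at h
  refine ⟨?_, ?_⟩
  · filter_upwards [h.ae_of_comp] with x hx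
    simpa only [he] using hx.2 (θ / ϑ)
  · simpa only [he, inv_div] using integrable_rpow_integral_exp (by positivity : 0 < θ / ϑ) h

theorem learnOpLimDefinedAt_of_hasExpMoments {α : ℝ} {f : S → ℝ} {s : S}
    (h : HasExpMoments ((Q ∘ₖ K) s) fun y => f (upd s y) + α * u y) :
    LearnOpLimDefinedAt α K Q upd u f s := by
  rw [Kernel.comp_apply] at h
  exact ⟨h.ae_of_comp.mono fun x hx => hx.integrable, integrable_exp_integral h⟩

theorem hasUniqueThinTailedFixedPoint_learnOp_and_learnOpLim {Q₀ : Measure (F × S)}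
    [IsProbabilityMeasure Q₀] (hupd : Measurable fun x : S × F => upd x.1 x.2)
    (hjoint : (Q₀.map Prod.snd ⊗ₘ (Q ∘ₖ K)).map (fun x : S × F => (x.2, upd x.1 x.2)) = Q₀)
    {β θ α : ℝ} (hβ₀ : 0 < β) (hβ₁ : β < 1) (hθ : 0 < θ) {r : ℝ} (hr : 1 < r)
    (hu : u ∈ orliczHeartObs Q₀ r) :
    (∀ ϑ : ℝ, 0 < ϑ → HasUniqueThinTailedFixedPoint Q₀ r (learnOp β θ ϑ α K Q upd u)
      (LearnOpDefinedAt θ ϑ α K Q upd u)) ∧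
    HasUniqueThinTailedFixedPoint Q₀ r (learnOpLim β α K Q upd u)
      (LearnOpLimDefinedAt α K Q upd u) := by
  have hinv : (Q₀.map Prod.snd ⊗ₘ (Q ∘ₖ K)).map (fun x : S × F => upd x.1 x.2) =
      Q₀.map Prod.snd := by
    conv_rhs => rw [← hjoint]
    rw [Measure.map_map measurable_snd (by fun_prop)]
    rfl
  -- The predictive law of the next observation is the stationary law of `φ`, so the integrability
  -- of `u` carries over.
  have hfst : (Q ∘ₖ K) ∘ₘ Q₀.map Prod.snd = Q₀.map Prod.fst := by
    conv_rhs => rw [← hjoint]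
    rw [Measure.map_map measurable_fst (by fun_prop), ← Measure.snd_compProd]
    rfl
  have huN : u ∈ orliczHeart ((Q ∘ₖ K) ∘ₘ Q₀.map Prod.snd) r := by
    rw [hfst]
    exact (mem_orliczHeart_map measurable_fst hu.1).2 hu.2
  have hr0 : 0 < r := zero_lt_one.trans hr
  have := Measure.isProbabilityMeasure_map (μ := Q₀) measurable_snd.aemeasurable
  refine ⟨fun ϑ hϑ => ?_, ?_⟩
  · exact (recursiveOperator_learnOp hβ₀ hβ₁ hθ hϑ hupd hinv hu.1).hasUniqueThinTailedFixedPoint hr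
      (const_mul_mem_orliczHeart huN hr0 _)
      fun f s h => learnOpDefinedAt_of_hasExpMoments hθ hϑ h
  · exact (recursiveOperator_learnOpLim hβ₀ hβ₁ hupd hinv hu.1).hasUniqueThinTailedFixedPoint hr
      (const_mul_mem_orliczHeart huN hr0 _)
      fun f s h => learnOpLimDefinedAt_of_hasExpMoments h

end Operators

theorem theorem4p1 {Ω F H S : Type*} [MeasurableSpace Ω] [MeasurableSpace F]
    [StandardBorelSpace F] [Nonempty F] [MeasurableSpace H] [MeasurableSpace S]
    (P : Measure Ω) [IsProbabilityMeasure P]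
    (obs : ℕ → Ω → F) (hid : ℕ → Ω → H) (stat : ℕ → Ω → S)
    (Qobs : Kernel H F) [IsMarkovKernel Qobs] (Qhid : Kernel H H) [IsMarkovKernel Qhid]
    (post : Kernel (F × S) H) [IsMarkovKernel post] (upd : S → F → S)
    (hS : LearningEnvironment P obs hid stat Qobs Qhid post upd)
    (β θ α : ℝ) (hβ₀ : 0 < β) (hβ₁ : β < 1) (hθ : 0 < θ)
    (u : F → ℝ) (r : ℝ) (hr : 1 < r)
    (hu : u ∈ orliczHeartObs (P.map (fun ω => (obs 0 ω, stat 0 ω))) r) :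
    (∀ ϑ : ℝ, 0 < ϑ →
      HasUniqueThinTailedFixedPoint (P.map (fun ω => (obs 0 ω, stat 0 ω))) r
        (learnOp β θ ϑ α
          (postGivenStat (P.map (fun ω => (obs 0 ω, stat 0 ω))) post) Qobs upd u)
        (LearnOpDefinedAt θ ϑ α
          (postGivenStat (P.map (fun ω => (obs 0 ω, stat 0 ω))) post) Qobs upd u)) ∧
    HasUniqueThinTailedFixedPoint (P.map (fun ω => (obs 0 ω, stat 0 ω))) r
      (learnOpLim β α
        (postGivenStat (P.map (fun ω => (obs 0 ω, stat 0 ω))) post) Qobs upd u)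
      (LearnOpLimDefinedAt α
        (postGivenStat (P.map (fun ω => (obs 0 ω, stat 0 ω))) post) Qobs upd u) := by
  have hX : Measurable fun ω => (obs 0 ω, stat 0 ω) :=
    (hS.measurable_obs 0).prodMk (hS.measurable_stat 0)
  have := Measure.isProbabilityMeasure_map (μ := P) hX.aemeasurable
  exact hasUniqueThinTailedFixedPoint_learnOp_and_learnOpLim hS.measurable_upd hS.map_obs_upd
    hβ₀ hβ₁ hθ hr hu
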